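/- Let $\pi=(\pi_k)_{k\ge 0}$ be a probability measure on $\{0,1,2,\dots\}$ with $\sum_{k\ge 1}k\pi_k=1$, $\pi_1<1$ and finite variance, and let $d\ge 1$ be the greatest common divisor of $\{k\ge 1:\pi_k>0\}$. Let $T$ be the Galton--Watson tree with offspring distribution $\pi$, i.e. the random plane tree in which the individuals (indexed by finite words) have independent numbers of children with law $\pi$. For $n$ with $\mathbf P(\#T=n)>0$, let $T_n$ be $T$ conditioned on having exactly $n$ vertices, with expectation $\mathbf E_n$, and let $\deg(x)$ be the number of vertices of $T_n$ adjacent to $x$. Then $\mathbf P(\#T=n)>0$ for all sufficiently large $n\equiv 1 \pmod d$, and the following holds. Fix $q>1$ and assume that $\sum_{k\ge 1}k^q\pi_k<\infty$. Then, for every integer $k_0\ge 0$, the random variables below are integrable, the series on the right is finite, and $$\lim_{\substack{n\to\infty\\ n\equiv 1\,(\mathrm{mod}\ d)}}\ \frac1n\,\mathbf E_n\Bigl[\sum_{x\in T_n}\deg(x)^q\,\mathbf 1_{\{\deg(x)\ge k_0\}}\Bigr]=\sum_{\substack{k\ge 0\\ k+1\ge k_0}}(k+1)^q\,\pi_k .$$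 -/

import Mathlib

open MeasureTheory ProbabilityTheory Filter Topology

noncomputable section

namespace GaltonWatson

/-- The family tree on the Ulam-Harris words (finite words in the letters `0, 1, 2, …`) in which
the individual `v` has `κ v` children `v0, v1, …, v(κ v - 1)`: the word `u = u₁ ⋯ uₘ` is a vertex
if and only if `uᵢ < κ (u₁ ⋯ uᵢ₋₁)` for every `i`. The empty word is the root. -/
def tree (κ : List ℕ → ℕ) : Set (List ℕ) :=
  {u | ∀ (v : List ℕ) (j : ℕ), v ++ [j] <+: u → j < κ v}

/-- The graph on all Ulam-Harris words in which every word is joined to its children. -/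
def parentGraph : SimpleGraph (List ℕ) where
  Adj u v := (∃ j, v = u ++ [j]) ∨ (∃ j, u = v ++ [j])
  symm := ⟨fun _ _ h => h.symm⟩
  loopless := ⟨fun u h => by rcases h with ⟨j, h⟩ | ⟨j, h⟩ <;> simp at h⟩

/-- The degree of the vertex `x` in the tree with vertex set `T`: the number of vertices of `T`
that are adjacent to `x`. -/
def degree (T : Set (List ℕ)) (x : List ℕ) : ℕ :=
  {y | y ∈ T ∧ parentGraph.Adj x y}.ncard

/-- `∑_{x ∈ T} deg(x) ^ q 1{deg(x) ≥ k₀}`, for a finite tree `T`. -/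
def truncatedDegreeMoment (q : ℝ) (k₀ : ℕ) (T : Set (List ℕ)) : ℝ :=
  ∑ᶠ x ∈ T, if k₀ ≤ degree T x then (degree T x : ℝ) ^ q else 0

/-- The period of a law on `ℕ`: the greatest common divisor of the `k ≥ 1` that it charges. -/
def period (π : Measure ℕ) : ℕ :=
  sSup {e | ∀ k, 1 ≤ k → 0 < π.real {k} → e ∣ k}

section Conditioning

variable {Ω : Type*} [MeasurableSpace Ω]

/-- The Galton-Watson tree in which the individual `u` has the random number `ξ u` of children. -/
def randomTree (ξ : List ℕ → Ω → ℕ) (ω : Ω) : Set (List ℕ) :=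
  tree fun u => ξ u ω

/-- The event that the tree is finite with exactly `n` vertices. -/
def sizeEvent (ξ : List ℕ → Ω → ℕ) (n : ℕ) : Set Ω :=
  {ω | (randomTree ξ ω).encard = n}

/-- The probability measure `P` conditioned on the tree having exactly `n` vertices; under it,
`randomTree ξ` is the conditioned Galton-Watson tree with `n` vertices. -/
def condMeasure (P : Measure Ω) (ξ : List ℕ → Ω → ℕ) (n : ℕ) : Measure Ω :=
  cond P (sizeEvent ξ n)

end Conditioning

end GaltonWatson

end

noncomputable section

namespace GaltonWatson

/-! Every vertex except the root has one more neighbour than it has children. The sum is therefore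
an additive functional `∑ f (κ x)` with `f k = (k+1)^q 1{k+1 ≥ k₀}`, up to an error at the root of
at most `(κ [] + 1)^q`.

Write `W_n` for the law of the sum of `n` independent offspring numbers (`walkMass`). The
Otter-Dwass formula `P(#T = n+1) = W_{n+1}(n)/(n+1)` (`measure_sizeEvent`) has a companion with a
marked vertex, `E[∑ f; #T = n+1] = ∑_k f(k) π_k W_n(n-k)` (`setLIntegral_forestSum`). Dividing, the
normalised conditional expectation equals `∑_k f(k) π_k W_n(n-k)/W_{n+1}(n)`. Both formulas are
special cases of formulas for forests. Removing one root at a time gives a recursion, and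
`forestMass_succ` and `forestMoment_succ` check that the explicit expressions solve it; this algebra
replaces the cycle lemma.

A local limit theorem, by Fourier inversion on the lattice of multiples of `d`, shows that `√n
W_n(n-a)` tends to the same positive constant for every fixed `a` (along `d ∣ n-a`) and that `√n
W_n` is uniformly bounded. Hence the ratios `W_n(n-k)/W_{n+1}(n)` are bounded and tend to 1 for
every charged `k`. Since `∑ (k+1)^q π_k` is finite, dominated convergence gives the limit
(`tendsto_tiltedMass_div`).

The root term is a sum of the same kind with an additional factor `k/n` (`setLIntegral_root`). This
factor is at most 1 in the range of summation and tends to 0 for fixed `k`, so the same dominated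
convergence removes the error without any moment beyond the `q`-th. -/

/-! ### Convolution powers and Fourier inversion. -/

/-- The coefficients of the `n`-th convolution power of `p`: the mass at `j` of a random walk with
step distribution `p` after `n` steps. -/
def walkMass (p : ℕ → ℝ) (n j : ℕ) : ℝ := PowerSeries.coeff j (PowerSeries.mk p ^ n)

lemma walkMass_zero (p : ℕ → ℝ) (j : ℕ) : walkMass p 0 j = if j = 0 then 1 else 0 := by
  simp [walkMass, PowerSeries.coeff_one]

lemma walkMass_succ (p : ℕ → ℝ) (n j : ℕ) :
    walkMass p (n + 1) j =
      ∑ kl ∈ Finset.HasAntidiagonal.antidiagonal j, walkMass p n kl.1 * p kl.2 := by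
  simp [walkMass, pow_succ, PowerSeries.coeff_mul]

lemma walkMass_nonneg {p : ℕ → ℝ} (hp : ∀ k, 0 ≤ p k) (n j : ℕ) : 0 ≤ walkMass p n j := by
  induction n generalizing j with
  | zero => rw [walkMass_zero]; split_ifs <;> norm_num
  | succ n ih =>
    rw [walkMass_succ]
    exact Finset.sum_nonneg fun kl _ => mul_nonneg (ih _) (hp _)

lemma walkMass_eq_zero_of_not_dvd {p : ℕ → ℝ} {d : ℕ} (hd : ∀ k, p k ≠ 0 → d ∣ k) (n j : ℕ)
    (hj : ¬ d ∣ j) : walkMass p n j = 0 := by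
  induction n generalizing j with
  | zero =>
    rw [walkMass_zero, if_neg]
    rintro rfl
    exact hj (dvd_zero d)
  | succ n ih =>
    rw [walkMass_succ]
    refine Finset.sum_eq_zero fun kl hkl => ?_
    rw [Finset.HasAntidiagonal.mem_antidiagonal] at hkl
    by_cases h1 : d ∣ kl.1
    · have h2 : p kl.2 = 0 := by
        by_contra h
        exact hj (hkl ▸ dvd_add h1 (hd _ h))
      rw [h2, mul_zero]
    · rw [ih _ h1, zero_mul]

lemma summable_norm_mul_pow {a : ℕ → ℝ} (ha : ∀ k, 0 ≤ a k) (hs : Summable a) {z : ℂ}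
    (hz : ‖z‖ ≤ 1) : Summable fun k => ‖(a k : ℂ) * z ^ k‖ := by
  refine Summable.of_nonneg_of_le (fun _ => norm_nonneg _) (fun k => ?_) hs
  rw [norm_mul, norm_pow, Complex.norm_real, Real.norm_of_nonneg (ha k)]
  exact mul_le_of_le_one_right (ha k) (pow_le_one₀ (norm_nonneg z) hz)

/-- The generating function of a convolution power is the power of the generating function, as a
Cauchy product of absolutely convergent series on the closed disc. -/
lemma hasSum_walkMass_mul_pow {p : ℕ → ℝ} (hp : ∀ k, 0 ≤ p k) (hs : Summable p) {z : ℂ}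
    (hz : ‖z‖ ≤ 1) (n : ℕ) :
    (Summable fun j => ‖(walkMass p n j : ℂ) * z ^ j‖) ∧
    HasSum (fun j => (walkMass p n j : ℂ) * z ^ j) ((∑' k, (p k : ℂ) * z ^ k) ^ n) := by
  induction n with
  | zero =>
    have h : ∀ j, j ∉ ({0} : Finset ℕ) → (walkMass p 0 j : ℂ) * z ^ j = 0 := by
      intro j hj
      rw [walkMass_zero, if_neg (by simpa using hj)]
      simp
    refine ⟨?_, ?_⟩
    · exact summable_of_ne_finset_zero (s := {0}) fun j hj => by rw [h j hj, norm_zero]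
    · convert hasSum_single 0 fun j hj => h j (by simpa using hj) using 1
      simp [walkMass_zero]
  | succ n ih =>
    have hp' := summable_norm_mul_pow hp hs hz
    have key : ∀ j, (walkMass p (n + 1) j : ℂ) * z ^ j =
        ∑ kl ∈ Finset.HasAntidiagonal.antidiagonal j,
        ((walkMass p n kl.1 : ℂ) * z ^ kl.1) * ((p kl.2 : ℂ) * z ^ kl.2) := by
      intro j
      rw [walkMass_succ, Complex.ofReal_sum, Finset.sum_mul]
      refine Finset.sum_congr rfl fun kl hkl => ?_
      rw [← Finset.HasAntidiagonal.mem_antidiagonal.1 hkl, pow_add]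
      push_cast
      ring
    have h1 := summable_norm_sum_mul_antidiagonal_of_summable_norm ih.1 hp'
    simp_rw [key]
    refine ⟨h1, ?_⟩
    rw [pow_succ, ← ih.2.tsum_eq, tsum_mul_tsum_eq_tsum_sum_antidiagonal_of_summable_norm ih.1 hp']
    exact h1.of_norm.hasSum

lemma hasSum_walkMass {p : ℕ → ℝ} (hp : ∀ k, 0 ≤ p k) (hs : HasSum p 1) (n : ℕ) :
    HasSum (walkMass p n) 1 := by
  have h := (hasSum_walkMass_mul_pow hp hs.summable (z := 1) (by simp) n).2
  simp only [one_pow, mul_one] at h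
  rw [← Complex.ofReal_tsum, hs.tsum_eq] at h
  simp only [Complex.ofReal_one, one_pow] at h
  rw [← Complex.ofReal_one] at h
  exact Complex.hasSum_ofReal.1 h

/-- Coefficient extraction by Fourier inversion on a lattice of span `d`. -/
lemma two_pi_div_mul_coeff_eq_integral {a : ℕ → ℝ} (ha : ∀ k, 0 ≤ a k) (hs : Summable a) {d : ℕ}
    (hd : 0 < d) (had : ∀ k, a k ≠ 0 → d ∣ k) {j : ℕ} (hj : d ∣ j) :
    (2 * Real.pi / d * a j : ℂ) = ∫ t in (-(Real.pi / d))..(Real.pi / d),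
      (∑' k, (a k : ℂ) * Complex.exp (t * Complex.I) ^ k) * Complex.exp (-(j * t * Complex.I)) := by
  have hd' : (d : ℝ) ≠ 0 := by positivity
  have hdc : (d : ℂ) ≠ 0 := by exact_mod_cast hd'
  have hsum : HasSum (fun k => ∫ t in (-(Real.pi / d))..(Real.pi / d),
      (a k : ℂ) * Complex.exp (t * Complex.I) ^ k * Complex.exp (-(j * t * Complex.I)))
      (∫ t in (-(Real.pi / d))..(Real.pi / d),
        (∑' k, (a k : ℂ) * Complex.exp (t * Complex.I) ^ k) *
          Complex.exp (-(j * t * Complex.I))) := by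
    refine intervalIntegral.hasSum_integral_of_dominated_convergence (fun k _ => a k) ?_ ?_ ?_ ?_ ?_
    · intro k
      refine Continuous.aestronglyMeasurable ?_
      fun_prop
    · intro k
      refine Eventually.of_forall fun t _ => le_of_eq ?_
      rw [norm_mul, norm_mul, norm_pow, Complex.norm_exp_ofReal_mul_I, Complex.norm_real,
        Real.norm_of_nonneg (ha k), one_pow, mul_one,
        show -(j * t * Complex.I : ℂ) = ((-(j * t) : ℝ) : ℂ) * Complex.I by push_cast; ring,
        Complex.norm_exp_ofReal_mul_I, mul_one]
    · exact Eventually.of_forall fun _ _ => hs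
    · simp
    · refine Eventually.of_forall fun t _ => HasSum.mul_right _ ?_
      refine (summable_norm_mul_pow ha hs ?_).of_norm.hasSum
      rw [Complex.norm_exp_ofReal_mul_I]
  rw [← hsum.tsum_eq, tsum_eq_single j]
  · have : ∀ t : ℝ, (a j : ℂ) * Complex.exp (t * Complex.I) ^ j * Complex.exp (-(j * t * Complex.I))
        = a j := by
      intro t
      rw [← Complex.exp_nat_mul, mul_assoc, ← Complex.exp_add]
      ring_nf
      simp
    simp_rw [this]
    rw [intervalIntegral.integral_const]
    simp only [Complex.real_smul]
    push_cast
    ring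
  · intro k hkj
    by_cases hk : a k = 0
    · simp [hk]
    obtain ⟨k', rfl⟩ := had k hk
    obtain ⟨j', rfl⟩ := hj
    have hne : ((d : ℂ) * (k' - j') * Complex.I) ≠ 0 := by
      refine mul_ne_zero (mul_ne_zero hdc (sub_ne_zero.2 ?_)) Complex.I_ne_zero
      intro h
      exact hkj (by rw [Nat.cast_injective h])
    have : ∀ t : ℝ, (a (d * k') : ℂ) * Complex.exp (t * Complex.I) ^ (d * k') *
        Complex.exp (-((d * j' : ℕ) * t * Complex.I))
        = a (d * k') * Complex.exp ((d : ℂ) * (k' - j') * Complex.I * t) := by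
      intro t
      rw [← Complex.exp_nat_mul, mul_assoc, ← Complex.exp_add]
      push_cast
      ring_nf
    simp_rw [this]
    rw [intervalIntegral.integral_const_mul, integral_exp_mul_complex hne, sub_eq_zero.2, zero_div,
      mul_zero]
    -- The exponents at the two endpoints differ by `d(k'-j') * (2π/d) * i`, a multiple of `2πi`, so
    -- only the term `k = j` survives.
    refine Complex.exp_eq_exp_iff_exists_int.2 ⟨(k' : ℤ) - j', ?_⟩
    push_cast
    field_simp
    ring

/-! ### Arithmetic of the support of the offspring law. -/

section Period

variable {π : Measure ℕ}

lemma exists_pos_mass (hmean : HasSum (fun k : ℕ => (k : ℝ) * π.real {k}) 1) :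
    ∃ k, 1 ≤ k ∧ 0 < π.real {k} := by
  by_contra! h
  have h0 : ∀ k : ℕ, (k : ℝ) * π.real {k} = 0 := by
    intro k
    rcases Nat.eq_zero_or_pos k with rfl | hk
    · simp
    · rw [le_antisymm (h k hk) measureReal_nonneg, mul_zero]
  simp_rw [h0] at hmean
  exact zero_ne_one (hasSum_zero.unique hmean)

lemma period_mem (hmean : HasSum (fun k : ℕ => (k : ℝ) * π.real {k}) 1) :
    (∀ k, 1 ≤ k → 0 < π.real {k} → period π ∣ k) ∧
    ∀ e, (∀ k, 1 ≤ k → 0 < π.real {k} → e ∣ k) → e ≤ period π := by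
  obtain ⟨k, hk1, hk⟩ := exists_pos_mass hmean
  have hb : BddAbove {e | ∀ k, 1 ≤ k → 0 < π.real {k} → e ∣ k} :=
    ⟨k, fun e he => Nat.le_of_dvd hk1 (he k hk1 hk)⟩
  exact ⟨Nat.sSup_mem (s := {e | ∀ k, 1 ≤ k → 0 < π.real {k} → e ∣ k})
    ⟨1, fun k _ _ => one_dvd k⟩ hb, fun e he => le_csSup hb he⟩

lemma period_dvd (hmean : HasSum (fun k : ℕ => (k : ℝ) * π.real {k}) 1) {k : ℕ}
    (hk : π.real {k} ≠ 0) : period π ∣ k := by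
  rcases Nat.eq_zero_or_pos k with rfl | hk1
  · exact dvd_zero _
  · exact (period_mem hmean).1 k hk1 (lt_of_le_of_ne measureReal_nonneg hk.symm)

lemma period_pos (hmean : HasSum (fun k : ℕ => (k : ℝ) * π.real {k}) 1) : 0 < period π :=
  (period_mem hmean).2 1 fun k _ _ => one_dvd k

/-- `period` is only the largest common divisor in size. Its lcm with `e` is again a common divisor,
hence no larger, which upgrades size to divisibility. -/
lemma dvd_period (hmean : HasSum (fun k : ℕ => (k : ℝ) * π.real {k}) 1) {e : ℕ}
    (he : ∀ k, 1 ≤ k → 0 < π.real {k} → e ∣ k) : e ∣ period π := by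
  have h := (period_mem hmean).2 (Nat.lcm e (period π)) fun k h1 h2 =>
    Nat.lcm_dvd (he k h1 h2) ((period_mem hmean).1 k h1 h2)
  have h2 : 0 < Nat.lcm e (period π) := by
    obtain ⟨k, hk1, hk⟩ := exists_pos_mass hmean
    exact Nat.pos_of_dvd_of_pos
      (Nat.lcm_dvd (he k hk1 hk) ((period_mem hmean).1 k hk1 hk)) hk1
  have h3 : Nat.lcm e (period π) = period π :=
    le_antisymm h (Nat.le_of_dvd h2 (Nat.dvd_lcm_right e _))
  exact h3 ▸ Nat.dvd_lcm_left e (period π)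

lemma hasSum_mass (π : Measure ℕ) [IsProbabilityMeasure π] :
    HasSum (fun k => π.real {k}) 1 := by
  have h := integrable_const (μ := π) (1 : ℝ)
  have h1 := hasSum_integral_measure (μ := fun k : ℕ => π {k} • Measure.dirac k)
    (f := fun _ => (1 : ℝ))
    (by rwa [Measure.sum_smul_dirac])
  rw [Measure.sum_smul_dirac] at h1
  simpa [measureReal_def] using h1

/-- If 0 carried no mass, all terms of `∑ (k-1) π_k = 0` would be nonnegative, hence zero, and the
law would be concentrated at 1. -/
lemma mass_zero_pos [IsProbabilityMeasure π]
    (hmean : HasSum (fun k : ℕ => (k : ℝ) * π.real {k}) 1)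
    (hone : π.real {1} < 1) : 0 < π.real {0} := by
  by_contra h0
  have h0 : π.real {0} = 0 := le_antisymm (not_lt.1 h0) measureReal_nonneg
  have hsub := hmean.sub (hasSum_mass π)
  have hnn : ∀ k : ℕ, 0 ≤ (k : ℝ) * π.real {k} - π.real {k} := by
    intro k
    rcases Nat.eq_zero_or_pos k with rfl | hk
    · simp [h0]
    · have : (1 : ℝ) ≤ k := by exact_mod_cast hk
      nlinarith [measureReal_nonneg (μ := π) (s := {k})]
  rw [sub_self, hasSum_zero_iff_of_nonneg hnn] at hsub
  have hz : ∀ k : ℕ, k ≠ 1 → π.real {k} = 0 := by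
    intro k hk
    have := congrFun hsub k
    have hk' : (k : ℝ) - 1 ≠ 0 := sub_ne_zero.2 (by exact_mod_cast hk)
    have h2 : ((k : ℝ) - 1) * π.real {k} = 0 := by simpa [sub_mul] using this
    exact (mul_eq_zero.1 h2).resolve_left hk'
  have := (hasSum_single 1 hz).unique (hasSum_mass π)
  exact hone.ne this

end Period

/-! ### The characteristic function of a centred step. -/

section CharFun

/-- The characteristic function of the centred step distribution. -/
def stepCharFun (π : Measure ℕ) (t : ℝ) : ℂ := charFun (π.map fun k : ℕ => (k : ℝ) - 1) t

/-- The second moment of the centred step. -/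
def stepVar (π : Measure ℕ) : ℝ := ∫ k : ℕ, ((k : ℝ) - 1) ^ 2 ∂π

variable {π : Measure ℕ} [IsProbabilityMeasure π]

lemma integrable_of_summable {f : ℕ → ℝ} (hf : Summable fun k => |f k| * π.real {k}) :
    Integrable f π := by
  have h : Integrable f (Measure.sum fun k : ℕ => π {k} • Measure.dirac k) := by
    refine integrable_sum_measure (fun k => ?_) ?_
    · exact (integrable_dirac (by simp)).smul_measure (by simp)
    · simpa [integral_smul_measure, measureReal_def, mul_comm] using hf
  rwa [Measure.sum_smul_dirac] at h

lemma stepCharFun_eq (t : ℝ) : stepCharFun π t =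
    (∑' k : ℕ, (π.real {k} : ℂ) * Complex.exp (t * Complex.I) ^ k) *
      Complex.exp (-(t * Complex.I)) := by
  have hb : ∀ k : ℕ, ‖Complex.exp (t * (((k : ℝ) - 1 : ℝ) : ℂ) * Complex.I)‖ ≤ 1 := by
    intro k
    rw [← Complex.ofReal_mul, Complex.norm_exp_ofReal_mul_I]
  rw [stepCharFun, charFun_apply_real, integral_map (by fun_prop) (by fun_prop),
    integral_countable (Integrable.of_bound (by fun_prop) 1 (Eventually.of_forall hb)),
    ← tsum_mul_right]
  refine tsum_congr fun k => ?_
  rw [Complex.real_smul, mul_assoc (π.real {k} : ℂ), ← Complex.exp_nat_mul, ← Complex.exp_add]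
  push_cast
  ring_nf

lemma stepCharFun_continuous : Continuous (stepCharFun π) := by
  have : IsProbabilityMeasure (π.map fun k : ℕ => (k : ℝ) - 1) :=
    Measure.isProbabilityMeasure_map (by fun_prop)
  exact continuous_charFun

lemma walkMass_eq_integral {d : ℕ} (hd : 0 < d) (hdvd : ∀ k, π.real {k} ≠ 0 → d ∣ k) (n : ℕ) {j : ℕ}
    (hj : d ∣ j) :
    (2 * Real.pi / d * walkMass (fun k => π.real {k}) n j : ℂ) =
      ∫ t in (-(Real.pi / d))..(Real.pi / d),
        stepCharFun π t ^ n * Complex.exp (((n : ℤ) - j : ℤ) * t * Complex.I) := by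
  have hp : ∀ k, 0 ≤ π.real {k} := fun _ => measureReal_nonneg
  rw [two_pi_div_mul_coeff_eq_integral (walkMass_nonneg hp n)
    (hasSum_walkMass hp (hasSum_mass π) n).summable hd
    (fun k hk => by_contra fun h => hk (walkMass_eq_zero_of_not_dvd hdvd n k h)) hj]
  congr 1
  ext t
  rw [(hasSum_walkMass_mul_pow hp (hasSum_mass π).summable
    (Complex.norm_exp_ofReal_mul_I t).le n).2.tsum_eq, stepCharFun_eq, mul_pow,
    ← Complex.exp_nat_mul, mul_assoc, mul_assoc, ← Complex.exp_add]
  congr 2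
  push_cast
  ring

/-- Modulus 1 forces equality in the triangle inequality. Because 0 is charged, every `z^k` with `k`
charged must then be aligned with `z^0 = 1`, so `z^d = 1`; the range of `t` excludes this. -/
lemma norm_stepCharFun_lt_one (hmean : HasSum (fun k : ℕ => (k : ℝ) * π.real {k}) 1)
    (hone : π.real {1} < 1) {t : ℝ} (ht0 : t ≠ 0) (ht : |t| ≤ Real.pi / period π) :
    ‖stepCharFun π t‖ < 1 := by
  by_contra! hge
  have hp0 := mass_zero_pos hmean hone
  have hz : ‖Complex.exp (t * Complex.I)‖ = 1 := Complex.norm_exp_ofReal_mul_I t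
  set z := Complex.exp (t * Complex.I) with hzdef
  have hsum := summable_norm_mul_pow (fun k => measureReal_nonneg (μ := π) (s := {k}))
    (hasSum_mass π).summable hz.le
  have hcos : ∀ k : ℕ, 1 ≤ k → 0 < π.real {k} → Real.cos (k * t) = 1 := by
    intro k hk1 hk
    have h1 : ‖stepCharFun π t‖ = ‖∑' k : ℕ, (π.real {k} : ℂ) * z ^ k‖ := by
      rw [stepCharFun_eq, norm_mul,
        show -(t * Complex.I : ℂ) = ((-t : ℝ) : ℂ) * Complex.I by push_cast; ring,
        Complex.norm_exp_ofReal_mul_I, mul_one]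
    have hk0 : (0 : ℕ) ∉ ({k} : Finset ℕ) := by simp; omega
    have hsplit := hsum.of_norm.sum_add_tsum_compl (s := {0, k})
    have hsplit' := (hasSum_mass π).summable.sum_add_tsum_compl (s := {0, k})
    rw [(hasSum_mass π).tsum_eq] at hsplit'
    rw [Finset.sum_insert hk0, Finset.sum_singleton] at hsplit hsplit'
    -- All atoms other than 0 and `k` contribute at most their mass, so these two atoms alone must
    -- already attain equality.
    have h2 : ‖∑' x : ↑((({0, k} : Finset ℕ) : Set ℕ)ᶜ), (π.real {(x : ℕ)} : ℂ) * z ^ (x : ℕ)‖ ≤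
        ∑' x : ↑((({0, k} : Finset ℕ) : Set ℕ)ᶜ), π.real {(x : ℕ)} := by
      have := norm_tsum_le_tsum_norm (hsum.subtype ((({0, k} : Finset ℕ) : Set ℕ)ᶜ))
      refine this.trans (le_of_eq (tsum_congr fun x => ?_))
      simp [hz]
    have h3 : π.real {0} + π.real {k} ≤ ‖(π.real {0} : ℂ) * z ^ 0 + (π.real {k} : ℂ) * z ^ k‖ := by
      have h4 := norm_add_le ((π.real {0} : ℂ) * z ^ 0 + (π.real {k} : ℂ) * z ^ k)
        (∑' x : ↑((({0, k} : Finset ℕ) : Set ℕ)ᶜ), (π.real {(x : ℕ)} : ℂ) * z ^ (x : ℕ))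
      rw [hsplit, ← h1] at h4
      linarith
    have h5 : z ^ k = Complex.exp ((k * t : ℝ) * Complex.I) := by
      rw [hzdef, ← Complex.exp_nat_mul]
      push_cast
      ring_nf
    have h6 : ‖(π.real {0} : ℂ) * z ^ 0 + (π.real {k} : ℂ) * z ^ k‖ ^ 2 =
        π.real {0} ^ 2 + π.real {k} ^ 2 + 2 * π.real {0} * π.real {k} * Real.cos (k * t) := by
      rw [h5, ← Complex.normSq_eq_norm_sq, Complex.normSq_apply]
      simp only [pow_zero, mul_one, Complex.add_re, Complex.add_im, Complex.ofReal_re,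
        Complex.ofReal_im, Complex.re_ofReal_mul, Complex.im_ofReal_mul,
        Complex.exp_ofReal_mul_I_re, Complex.exp_ofReal_mul_I_im]
      nlinarith [Real.sin_sq_add_cos_sq (k * t)]
    have h7 := pow_le_pow_left₀ (by positivity) h3 2
    rw [h6] at h7
    have h8 : 0 < 2 * π.real {0} * π.real {k} := by positivity
    refine le_antisymm (Real.cos_le_one _) ?_
    nlinarith
  -- `G` consists of the integers `m` with `m t ∈ 2πℤ`. Its generator divides every charged `k`,
  -- hence the period, so the period lies in `G`.
  let G : AddSubgroup ℤ := (AddSubgroup.zmultiples (2 * Real.pi)).comap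
    (zmultiplesHom ℝ t)
  obtain ⟨e, he⟩ := Int.subgroup_cyclic G
  have hG : ∀ m : ℤ, m ∈ G ↔ ∃ n : ℤ, (n : ℝ) * (2 * Real.pi) = m * t := by
    intro m
    simp [G, AddSubgroup.mem_comap, AddSubgroup.mem_zmultiples_iff]
  have hdG : ((period π : ℕ) : ℤ) ∈ G := by
    rw [he, AddSubgroup.mem_closure_singleton]
    have h1 : e.natAbs ∣ period π := by
      refine dvd_period hmean fun k hk1 hk => ?_
      obtain ⟨n, hn⟩ := (Real.cos_eq_one_iff _).1 (hcos k hk1 hk)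
      have : (k : ℤ) ∈ G := (hG _).2 ⟨n, by simpa using hn⟩
      rw [he, AddSubgroup.mem_closure_singleton] at this
      obtain ⟨m, hm⟩ := this
      refine Int.natCast_dvd_natCast.1 (Int.natAbs_dvd.2 ⟨m, ?_⟩)
      rw [← hm, smul_eq_mul, mul_comm]
    obtain ⟨m, hm⟩ := Int.natAbs_dvd.1 (Int.natCast_dvd_natCast.2 h1)
    exact ⟨m, by rw [hm, smul_eq_mul, mul_comm]⟩
  obtain ⟨n, hn⟩ := (hG _).1 hdG
  have hdpos : (0 : ℝ) < period π := by exact_mod_cast period_pos hmean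
  have h1 : |(n : ℝ) * (2 * Real.pi)| ≤ Real.pi := by
    rw [hn, abs_mul, Int.cast_natCast, abs_of_pos hdpos]
    calc _ ≤ (period π : ℝ) * (Real.pi / period π) := by gcongr
      _ = Real.pi := by field_simp
  -- `|n| * 2π ≤ π` leaves only `n = 0`.
  have h2 : n = 0 := by
    rw [abs_mul, abs_of_pos Real.two_pi_pos] at h1
    have h3 : |(n : ℝ)| < 1 := by nlinarith [Real.pi_pos]
    rw [← Int.cast_abs] at h3
    exact Int.abs_lt_one_iff.1 (by exact_mod_cast h3)
  rw [h2] at hn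
  simp only [Int.cast_zero, zero_mul, Int.cast_natCast] at hn
  rcases mul_eq_zero.1 hn.symm with h | h
  · exact hdpos.ne' h
  · exact ht0 h

end CharFun

/-! ### The local limit theorem. -/

section LocalLimit

variable {π : Measure ℕ}

lemma integrable_natCast [IsProbabilityMeasure π]
    (hmean : HasSum (fun k : ℕ => (k : ℝ) * π.real {k}) 1) :
    Integrable (fun k : ℕ => (k : ℝ)) π :=
  integrable_of_summable (by simpa using hmean.summable)

lemma integral_step [IsProbabilityMeasure π]
    (hmean : HasSum (fun k : ℕ => (k : ℝ) * π.real {k}) 1) :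
    ∫ k : ℕ, ((k : ℝ) - 1) ∂π = 0 := by
  have h := integrable_natCast hmean
  rw [integral_sub h (integrable_const _), integral_countable h]
  have h1 : ∑' k : ℕ, π.real {k} • (k : ℝ) = 1 := by
    rw [← hmean.tsum_eq]
    exact tsum_congr fun k => by rw [smul_eq_mul, mul_comm]
  rw [h1]
  simp

lemma integrable_step_sq [IsProbabilityMeasure π]
    (hvar : Summable fun k : ℕ => (k : ℝ) ^ 2 * π.real {k}) :
    Integrable (fun k : ℕ => ((k : ℝ) - 1) ^ 2) π := by
  refine integrable_of_summable (Summable.of_nonneg_of_le (fun k => by positivity) (fun k => ?_)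
    (hvar.add (hasSum_mass π).summable))
  rw [abs_of_nonneg (sq_nonneg _), ← add_one_mul]
  gcongr
  nlinarith [(Nat.cast_nonneg k : (0 : ℝ) ≤ k)]

lemma stepVar_pos [IsProbabilityMeasure π]
    (hmean : HasSum (fun k : ℕ => (k : ℝ) * π.real {k}) 1)
    (hone : π.real {1} < 1) (hvar : Summable fun k : ℕ => (k : ℝ) ^ 2 * π.real {k}) :
    0 < stepVar π := by
  have hi := integrable_step_sq hvar
  have h0 := mass_zero_pos hmean hone
  have hs : Summable fun k : ℕ => π.real {k} * ((k : ℝ) - 1) ^ 2 := by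
    refine Summable.of_nonneg_of_le (fun k => by positivity) (fun k => ?_)
      (hvar.add (hasSum_mass π).summable)
    rw [← add_one_mul, mul_comm]
    gcongr
    nlinarith [(Nat.cast_nonneg k : (0 : ℝ) ≤ k)]
  rw [stepVar, integral_countable hi]
  simp only [smul_eq_mul]
  refine hs.tsum_pos (fun k => by positivity) 0 ?_
  simpa using h0

/-- Rescaling to unit variance, the form in which the Taylor expansion and the central limit theorem
for characteristic functions are applied. -/
lemma stepCharFun_eq_normalized {v : ℝ} (hv : 0 < v) (t : ℝ) :
    stepCharFun π t = charFun (π.map fun k : ℕ => ((k : ℝ) - 1) / √v) (√v * t) := by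
  have hv' : √v ≠ 0 := (Real.sqrt_pos.2 hv).ne'
  rw [stepCharFun, charFun_apply_real, charFun_apply_real, integral_map (by fun_prop) (by fun_prop),
    integral_map (by fun_prop) (by fun_prop)]
  refine integral_congr_ae (Eventually.of_forall fun k => ?_)
  dsimp only
  rw [← Complex.ofReal_mul, ← Complex.ofReal_mul]
  congr 3
  field_simp

lemma normalized_mean [IsProbabilityMeasure π]
    (hmean : HasSum (fun k : ℕ => (k : ℝ) * π.real {k}) 1) :
    π[fun k : ℕ => ((k : ℝ) - 1) / √(stepVar π)] = 0 := by
  rw [integral_div, integral_step hmean, zero_div]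

lemma normalized_sq (hv : 0 < stepVar π) :
    π[(fun k : ℕ => ((k : ℝ) - 1) / √(stepVar π)) ^ 2] = 1 := by
  simp only [Pi.pow_apply, div_pow]
  rw [integral_div, Real.sq_sqrt hv.le]
  exact div_self hv.ne'

lemma stepCharFun_taylor [IsProbabilityMeasure π]
    (hmean : HasSum (fun k : ℕ => (k : ℝ) * π.real {k}) 1)
    (hv : 0 < stepVar π) :
    (fun t : ℝ => stepCharFun π t - (1 - stepVar π * t ^ 2 / 2)) =o[𝓝 0] fun t : ℝ => t ^ 2 := by
  have h := taylor_charFun_two (P := π) (by fun_prop) (normalized_mean hmean) (normalized_sq hv)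
  have ht : Tendsto (fun t : ℝ => √(stepVar π) * t) (𝓝 0) (𝓝 0) := by
    have : Continuous fun t : ℝ => √(stepVar π) * t := by fun_prop
    simpa using this.tendsto 0
  have h2 := h.comp_tendsto ht
  have h3 : ((fun t : ℝ => t ^ 2) ∘ fun t => √(stepVar π) * t) = fun t => stepVar π * t ^ 2 := by
    ext t
    simp [mul_pow, Real.sq_sqrt hv.le]
  rw [h3] at h2
  refine (h2.of_const_mul_right).congr_left fun t => ?_
  simp only [Function.comp]
  rw [stepCharFun_eq_normalized hv, ← Complex.ofReal_pow, mul_pow, Real.sq_sqrt hv.le]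
  push_cast
  ring

lemma stepCharFun_pow_tendsto [IsProbabilityMeasure π]
    (hmean : HasSum (fun k : ℕ => (k : ℝ) * π.real {k}) 1)
    (hv : 0 < stepVar π) (s : ℝ) :
    Tendsto (fun n : ℕ => stepCharFun π ((√n)⁻¹ * s) ^ n) atTop
      (𝓝 (Complex.exp (-(stepVar π * s ^ 2 / 2)))) := by
  have h := tendsto_charFun_inv_sqrt_mul_pow (P := π) (by fun_prop) (normalized_mean hmean)
    (normalized_sq hv) (√(stepVar π) * s)
  convert! h using 2
  · rename_i n
    rw [stepCharFun_eq_normalized hv, mul_left_comm]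
  · rw [← Complex.ofReal_pow _ 2, ← Complex.ofReal_pow _ 2, mul_pow, Real.sq_sqrt hv.le]
    push_cast
    ring_nf

/-- Gaussian domination over a full period: near 0 from the Taylor expansion, elsewhere from
compactness and `norm_stepCharFun_lt_one`. Both give `1 - κ t²`, which is at most `exp (-κ t²)`. -/
lemma exists_norm_stepCharFun_le [IsProbabilityMeasure π]
    (hmean : HasSum (fun k : ℕ => (k : ℝ) * π.real {k}) 1)
    (hone : π.real {1} < 1) (hv : 0 < stepVar π) :
    ∃ κ > 0, ∀ t : ℝ, |t| ≤ Real.pi / period π → ‖stepCharFun π t‖ ≤ Real.exp (-κ * t ^ 2) := by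
  set v := stepVar π with hvdef
  have htay := (stepCharFun_taylor hmean hv).def (c := v / 4) (by positivity)
  -- An error of `v/4 * t²` leaves half of the quadratic term `v/2 * t²`. The cutoff `1/√v` below
  -- keeps `1 - v t²/2` nonnegative, so that it equals its norm.
  obtain ⟨δ, hδ, hball⟩ := Metric.eventually_nhds_iff.1 htay
  set η := min (δ / 2) (1 / √v) with hη
  have hηpos : 0 < η := by positivity
  have hnear : ∀ t : ℝ, |t| ≤ η → ‖stepCharFun π t‖ ≤ 1 - v / 4 * t ^ 2 := by
    intro t ht
    have h1 : ‖stepCharFun π t - (1 - v * t ^ 2 / 2)‖ ≤ v / 4 * ‖t ^ 2‖ := by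
      refine hball ?_
      rw [dist_zero_right, Real.norm_eq_abs]
      have := min_le_left (δ / 2) (1 / √v)
      linarith
    have h2 : t ^ 2 ≤ 1 / v := by
      rw [← sq_abs]
      calc |t| ^ 2 ≤ (1 / √v) ^ 2 := by
            gcongr
            exact ht.trans (min_le_right _ _)
        _ = 1 / v := by rw [div_pow, Real.sq_sqrt hv.le, one_pow]
    have h3 : v * t ^ 2 ≤ 1 := by
      calc v * t ^ 2 ≤ v * (1 / v) := by gcongr
        _ = 1 := by field_simp
    have h4 : ‖(1 - v * t ^ 2 / 2 : ℂ)‖ = 1 - v * t ^ 2 / 2 := by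
      rw [show (1 - v * t ^ 2 / 2 : ℂ) = ((1 - v * t ^ 2 / 2 : ℝ) : ℂ) by push_cast; ring,
        Complex.norm_real, Real.norm_of_nonneg (by linarith)]
    have h5 := norm_add_le (stepCharFun π t - (1 - v * t ^ 2 / 2)) (1 - v * t ^ 2 / 2 : ℂ)
    rw [sub_add_cancel, h4] at h5
    rw [Real.norm_of_nonneg (sq_nonneg t)] at h1
    linarith
  set R := Real.pi / period π
  have hK : IsCompact (Metric.closedBall (0 : ℝ) R ∩ {t : ℝ | η ≤ |t|}) :=
    (isCompact_closedBall 0 R).inter_right (isClosed_le continuous_const continuous_abs)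
  have hne : ∀ t ∈ Metric.closedBall (0 : ℝ) R ∩ {t : ℝ | η ≤ |t|}, t ≠ 0 := by
    rintro t ⟨-, ht⟩ rfl
    rw [Set.mem_ofPred_eq, abs_zero] at ht
    linarith
  obtain ⟨κ, hκ, hfar⟩ := hK.exists_forall_le' (a := 0)
    (f := fun t => (1 - ‖stepCharFun π t‖) / t ^ 2)
    (ContinuousOn.div (continuous_const.sub stepCharFun_continuous.norm).continuousOn
      (by fun_prop) fun t ht => pow_ne_zero 2 (hne t ht))
    fun t ht => div_pos (sub_pos.2 (norm_stepCharFun_lt_one hmean hone (hne t ht)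
      (by simpa using ht.1))) (sq_pos_of_ne_zero (hne t ht))
  refine ⟨min (v / 4) κ, by positivity, fun t ht => ?_⟩
  refine le_trans ?_ (Real.one_sub_le_exp_neg _ |>.trans_eq (by rw [← neg_mul]))
  rcases le_total |t| η with h | h
  · have h1 : min (v / 4) κ * t ^ 2 ≤ v / 4 * t ^ 2 := by
      gcongr
      exact min_le_left _ _
    linarith [hnear t h]
  · have hmem : t ∈ Metric.closedBall (0 : ℝ) R ∩ {t : ℝ | η ≤ |t|} := ⟨by simpa using ht, h⟩
    have h1 : min (v / 4) κ * t ^ 2 ≤ κ * t ^ 2 := by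
      gcongr
      exact min_le_right _ _
    have h2 := hfar t hmem
    have h3 : 0 < t ^ 2 := by have := hne t hmem; positivity
    rw [le_div_iff₀ h3] at h2
    linarith

/-- The rescaled Fourier integrand, extended by zero outside of a period. -/
def localLimitIntegrand (π : Measure ℕ) (a : ℤ) (n : ℕ) (t : ℝ) : ℂ :=
  (Set.Ioc (-(Real.pi / period π)) (Real.pi / period π)).indicator
    (fun t : ℝ => stepCharFun π t ^ n * Complex.exp (a * t * Complex.I)) t

/-- Fourier inversion after the substitution `s = √n t`; extending by zero makes the domain of
integration independent of `n`. -/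
lemma sqrt_mul_walkMass_eq [IsProbabilityMeasure π]
    (hmean : HasSum (fun k : ℕ => (k : ℝ) * π.real {k}) 1) {n j : ℕ}
    (hj : period π ∣ j) :
    ((2 * Real.pi / period π * (√n * walkMass (fun k => π.real {k}) n j) : ℝ) : ℂ) =
      ∫ s : ℝ, localLimitIntegrand π ((n : ℤ) - j) n ((√n)⁻¹ * s) := by
  have hR : -(Real.pi / period π) ≤ Real.pi / period π := by
    have : 0 ≤ Real.pi / period π := by positivity
    linarith
  have h := walkMass_eq_integral (period_pos hmean) (fun k hk => period_dvd hmean hk) n hj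
  rw [intervalIntegral.integral_of_le hR, ← integral_indicator measurableSet_Ioc] at h
  rw [Measure.integral_comp_mul_left (localLimitIntegrand π ((n : ℤ) - j) n), inv_inv,
    abs_of_nonneg (Real.sqrt_nonneg _)]
  unfold localLimitIntegrand
  rw [Complex.real_smul, ← h]
  push_cast
  ring

lemma norm_localLimitIntegrand_le {κ : ℝ}
    (hκ : ∀ t : ℝ, |t| ≤ Real.pi / period π → ‖stepCharFun π t‖ ≤ Real.exp (-κ * t ^ 2))
    (a : ℤ) {n : ℕ} (hn : 0 < n) (s : ℝ) :
    ‖localLimitIntegrand π a n ((√n)⁻¹ * s)‖ ≤ Real.exp (-κ * s ^ 2) := by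
  unfold localLimitIntegrand
  rw [Set.indicator_apply]
  split_ifs with h
  · have hn' : (0 : ℝ) < n := by exact_mod_cast hn
    have h1 := hκ ((√n)⁻¹ * s) (abs_le.2 ⟨h.1.le, h.2⟩)
    rw [norm_mul, norm_pow, ← Complex.ofReal_intCast, ← Complex.ofReal_mul,
      Complex.norm_exp_ofReal_mul_I, mul_one]
    calc _ ≤ Real.exp (-κ * ((√n)⁻¹ * s) ^ 2) ^ n := by gcongr
      _ = Real.exp (-κ * s ^ 2) := by
        rw [← Real.exp_nat_mul]
        congr 1
        rw [mul_pow, inv_pow, Real.sq_sqrt hn'.le]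
        field_simp
  · simp [Real.exp_nonneg]

/-- The phase has modulus 1, so the Gaussian bound is uniform in `j`. -/
lemma exists_sqrt_mul_walkMass_le [IsProbabilityMeasure π]
    (hmean : HasSum (fun k : ℕ => (k : ℝ) * π.real {k}) 1)
    (hone : π.real {1} < 1) (hvar : Summable fun k : ℕ => (k : ℝ) ^ 2 * π.real {k}) :
    ∃ C, ∀ n j : ℕ, √n * walkMass (fun k => π.real {k}) n j ≤ C := by
  obtain ⟨κ, hκ0, hκ⟩ := exists_norm_stepCharFun_le hmean hone (stepVar_pos hmean hone hvar)
  have hpos : 0 < 2 * Real.pi / period π := by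
    have : (0 : ℝ) < period π := by exact_mod_cast period_pos hmean
    positivity
  have hI : 0 ≤ ∫ s : ℝ, Real.exp (-κ * s ^ 2) := integral_nonneg fun _ => Real.exp_nonneg _
  refine ⟨(∫ s : ℝ, Real.exp (-κ * s ^ 2)) / (2 * Real.pi / period π), fun n j => ?_⟩
  rw [le_div_iff₀' hpos]
  rcases Nat.eq_zero_or_pos n with rfl | hn
  · simpa using hI
  by_cases hj : period π ∣ j
  · refine (le_abs_self _).trans ?_
    rw [← Real.norm_eq_abs, ← Complex.norm_real, sqrt_mul_walkMass_eq hmean hj]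
    exact norm_integral_le_of_norm_le (integrable_exp_neg_mul_sq hκ0)
      (Eventually.of_forall fun s => norm_localLimitIntegrand_le hκ _ hn s)
  · rw [walkMass_eq_zero_of_not_dvd (fun k hk => period_dvd hmean hk) n j hj]
    simpa using hI

/-- The local central limit theorem near the mean. -/
lemma exists_tendsto_sqrt_mul_walkMass [IsProbabilityMeasure π]
    (hmean : HasSum (fun k : ℕ => (k : ℝ) * π.real {k}) 1)
    (hone : π.real {1} < 1) (hvar : Summable fun k : ℕ => (k : ℝ) ^ 2 * π.real {k}) :
    ∃ γ > 0, ∀ (N J : ℕ → ℕ) (a : ℤ), Tendsto N atTop atTop →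
      (∀ᶠ m in atTop, (N m : ℤ) - J m = a ∧ period π ∣ J m) →
      Tendsto (fun m => √(N m) * walkMass (fun k => π.real {k}) (N m) (J m)) atTop (𝓝 γ) := by
  have hv := stepVar_pos hmean hone hvar
  obtain ⟨κ, hκ0, hκ⟩ := exists_norm_stepCharFun_le hmean hone hv
  have hper : (0 : ℝ) < period π := by exact_mod_cast period_pos hmean
  have hpos : 0 < 2 * Real.pi / period π := by positivity
  -- This constant is `d / √(2π v)`. It does not depend on `a`, since the phase `exp (i a s / √n)`
  -- tends to 1; ratios of masses at different offsets therefore tend to 1.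
  refine ⟨√(Real.pi / (stepVar π / 2)) / (2 * Real.pi / period π), by positivity, ?_⟩
  intro N J a hN hJ
  have hlim : Tendsto (fun n : ℕ => ∫ s : ℝ, localLimitIntegrand π a n ((√n)⁻¹ * s)) atTop
      (𝓝 (∫ s : ℝ, Complex.exp (-(stepVar π * s ^ 2 / 2)))) := by
    refine tendsto_integral_filter_of_dominated_convergence (fun s => Real.exp (-κ * s ^ 2))
      ?_ ?_ (integrable_exp_neg_mul_sq hκ0) ?_
    · refine Eventually.of_forall fun n => Measurable.aestronglyMeasurable ?_
      have h1 : Measurable (localLimitIntegrand π a n) := by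
        refine Measurable.indicator ?_ measurableSet_Ioc
        have := stepCharFun_continuous (π := π)
        fun_prop
      exact h1.comp (by fun_prop)
    · filter_upwards [eventually_gt_atTop 0] with n hn
      exact Eventually.of_forall fun s => norm_localLimitIntegrand_le hκ _ hn s
    · refine Eventually.of_forall fun s => ?_
      have h0 : Tendsto (fun n : ℕ => (√n)⁻¹ * s) atTop (𝓝 0) := by
        rw [← zero_mul s]
        exact .mul_const s (tendsto_inv_atTop_zero.comp <| Real.tendsto_sqrt_atTop.comp <|
          tendsto_natCast_atTop_atTop)
      have h1 : Tendsto (fun n : ℕ => Complex.exp (a * ((√n)⁻¹ * s : ℝ) * Complex.I)) atTop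
          (𝓝 1) := by
        have hc : Continuous fun x : ℝ => Complex.exp (a * x * Complex.I) := by fun_prop
        have := (hc.tendsto 0).comp h0
        rw [Complex.ofReal_zero, mul_zero, zero_mul, Complex.exp_zero] at this
        exact this
      have h2 := (stepCharFun_pow_tendsto hmean hv s).mul h1
      rw [mul_one] at h2
      refine h2.congr' ?_
      have hR : 0 < Real.pi / period π := by positivity
      filter_upwards [h0.eventually (Ioc_mem_nhds (neg_lt_zero.2 hR) hR)] with n hn
      rw [localLimitIntegrand, Set.indicator_of_mem (Set.mem_Ioc.2 hn)]
  have hval : ∫ s : ℝ, Complex.exp (-(stepVar π * s ^ 2 / 2)) =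
      ((√(Real.pi / (stepVar π / 2)) : ℝ) : ℂ) := by
    rw [← integral_gaussian, ← integral_complex_ofReal]
    congr 1
    ext s
    push_cast
    ring_nf
  rw [hval] at hlim
  have h3 := (Complex.continuous_re.tendsto _).comp (hlim.comp hN)
  rw [Complex.ofReal_re] at h3
  refine (h3.div_const (2 * Real.pi / period π)).congr' ?_
  filter_upwards [hJ] with m hm
  have h4 := sqrt_mul_walkMass_eq (n := N m) hmean hm.2
  rw [hm.1] at h4
  simp only [Function.comp]
  rw [← h4, Complex.ofReal_re]
  field_simp

end LocalLimit

/-! ### Algebraic identities behind the Otter-Dwass formula. -/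

section Kemperman

open PowerSeries Finset.HasAntidiagonal

/-- The expectation of `f` of the first step of a walk on the event that the walk is at `s` after
`n + 1` steps. -/
def tiltedMass (p f : ℕ → ℝ) (n s : ℕ) : ℝ :=
  ∑ kl ∈ antidiagonal s, f kl.1 * p kl.1 * walkMass p n kl.2

/-- The solution of the recursion for the probability that a forest of `k` trees has `l + k`
vertices. -/
def forestMass (p : ℕ → ℝ) (l k : ℕ) : ℝ :=
  if l + k = 0 then 1 else (k : ℝ) / ((l + k : ℕ) : ℝ) * walkMass p (l + k) l

/-- The solution of the recursion for the expectation of the sum of `f` over the numbers of children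
in a forest of `k` trees, on the event that it has `l + k` vertices. -/
def forestMoment (p f : ℕ → ℝ) (l k : ℕ) : ℝ := k * tiltedMass p f (l + k - 1) l

variable (p f : ℕ → ℝ)

lemma tiltedMass_eq_coeff (n s : ℕ) :
    tiltedMass p f n s = coeff s (PowerSeries.mk (fun k => f k * p k) * PowerSeries.mk p ^ n) := by
  simp [tiltedMass, coeff_mul, walkMass]

lemma tiltedMass_one (n s : ℕ) : tiltedMass p (fun _ => 1) n s = walkMass p (n + 1) s := by
  simp [tiltedMass_eq_coeff, walkMass, pow_succ']

lemma sum_mul_tiltedMass (n s : ℕ) :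
    ∑ kl ∈ antidiagonal s, p kl.1 * tiltedMass p f n kl.2 = tiltedMass p f (n + 1) s := by
  simp only [tiltedMass_eq_coeff, pow_succ', mul_left_comm _ (PowerSeries.mk p)]
  rw [coeff_mul]
  simp

lemma natCast_mul_mk_eq :
    PowerSeries.mk (fun k => (k : ℝ) * p k) = X * derivative ℝ (PowerSeries.mk p) := by
  ext n
  cases n with
  | zero => simp
  | succ n =>
    rw [coeff_succ_X_mul]
    simp [coeff_derivative, mul_comm]

/-- The derivative of a power expresses exchangeability of the steps: each of the `n + 1` steps has
the same share in the total `s`. -/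
lemma X_mul_derivative_pow (n : ℕ) :
    PowerSeries.mk (fun s => (s : ℝ) * walkMass p (n + 1) s) =
      ((n + 1 : ℕ) : ℝ) • (PowerSeries.mk (fun k => (k : ℝ) * p k) * PowerSeries.mk p ^ n) := by
  rw [natCast_mul_mk_eq p, natCast_mul_mk_eq (walkMass p (n + 1))]
  have : PowerSeries.mk (walkMass p (n + 1)) = PowerSeries.mk p ^ (n + 1) := by
    ext j
    simp [walkMass]
  rw [this, Derivation.leibniz_pow, Nat.add_sub_cancel, smul_eq_mul, ← Nat.cast_smul_eq_nsmul ℝ,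
    mul_smul_comm]
  ring_nf

lemma tiltedMass_natCast (n s : ℕ) :
    ((n : ℝ) + 1) * tiltedMass p (fun k => (k : ℝ)) n s = s * walkMass p (n + 1) s := by
  have h := congrArg (coeff s) (X_mul_derivative_pow p n)
  rw [coeff_mk, map_smul, smul_eq_mul] at h
  rw [tiltedMass_eq_coeff, h]
  push_cast
  rfl

/-- With a first step weighted by `f`, the other `n + 1` steps are exchangeable and add up to `s`
minus that first step. -/
lemma sum_natCast_mul_tiltedMass (n s : ℕ) :
    ((n : ℝ) + 1) * ∑ kl ∈ antidiagonal s, (kl.1 : ℝ) * p kl.1 * tiltedMass p f n kl.2 =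
      ∑ kl ∈ antidiagonal s, (kl.2 : ℝ) * (f kl.1 * p kl.1 * walkMass p (n + 1) kl.2) := by
  have h1 : ∑ kl ∈ antidiagonal s, (kl.1 : ℝ) * p kl.1 * tiltedMass p f n kl.2 =
      coeff s (PowerSeries.mk (fun k => (k : ℝ) * p k) *
        (PowerSeries.mk (fun k => f k * p k) * PowerSeries.mk p ^ n)) := by
    rw [coeff_mul]
    simp [tiltedMass_eq_coeff]
  have h2 : ∑ kl ∈ antidiagonal s, (kl.2 : ℝ) * (f kl.1 * p kl.1 * walkMass p (n + 1) kl.2) =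
      coeff s (PowerSeries.mk (fun k => f k * p k) *
        PowerSeries.mk (fun s => (s : ℝ) * walkMass p (n + 1) s)) := by
    rw [coeff_mul]
    simp [mul_left_comm]
  rw [h1, h2, X_mul_derivative_pow, mul_smul_comm, map_smul, mul_left_comm, smul_eq_mul]
  push_cast
  rfl

lemma sum_mul_forestMass (s t : ℕ) (h : 0 < s + t) :
    ∑ kl ∈ antidiagonal s, f kl.1 * p kl.1 * forestMass p kl.2 (t + kl.1) =
      (t * tiltedMass p f (s + t) s +
        ∑ kl ∈ antidiagonal s, (kl.1 : ℝ) * (f kl.1 * p kl.1 * walkMass p (s + t) kl.2)) /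
          ((s + t : ℕ) : ℝ) := by
  rw [tiltedMass, Finset.mul_sum, ← Finset.sum_add_distrib, Finset.sum_div]
  refine Finset.sum_congr rfl fun kl hkl => ?_
  rw [mem_antidiagonal] at hkl
  have e : kl.2 + (t + kl.1) = s + t := by omega
  rw [forestMass, e, if_neg h.ne']
  push_cast
  ring

/-- The first root has `k` children, which replace it as roots: `t + k` trees remain, with `s - k`
vertices that are not roots. The case `s + t = 0` is the empty remainder, where `forestMass` is 1 by
convention. -/
lemma forestMass_succ (s t : ℕ) :
    forestMass p s (t + 1) = ∑ kl ∈ antidiagonal s, p kl.1 * forestMass p kl.2 (t + kl.1) := by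
  rcases Nat.eq_zero_or_pos (s + t) with h | h
  · obtain ⟨rfl, rfl⟩ : s = 0 ∧ t = 0 := by omega
    simp [forestMass, walkMass_succ, walkMass_zero]
  · have h1 := sum_mul_forestMass p (fun _ => 1) s t h
    have h2 := tiltedMass_natCast p (s + t) s
    rw [tiltedMass_one] at h1
    simp only [one_mul] at h1
    have hpos : (0 : ℝ) < ((s + t : ℕ) : ℝ) := by exact_mod_cast h
    have h3 : ∑ kl ∈ antidiagonal s, (kl.1 : ℝ) * (p kl.1 * walkMass p (s + t) kl.2) =
        s * walkMass p (s + t + 1) s / (((s + t : ℕ) : ℝ) + 1) := by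
      rw [← h2, tiltedMass, mul_div_cancel_left₀ _ (by positivity)]
      simp [mul_assoc]
    rw [h1, h3, forestMass, if_neg (by omega), ← add_assoc]
    push_cast at hpos ⊢
    field_simp
    ring

/-- The same removal of a root, whose own value of `f` is added. The identity reduces to writing the
total `s` as the marked step plus the remaining ones (`h5`). -/
lemma forestMoment_succ (s t : ℕ) :
    forestMoment p f s (t + 1) = ∑ kl ∈ antidiagonal s,
      p kl.1 * (f kl.1 * forestMass p kl.2 (t + kl.1) + forestMoment p f kl.2 (t + kl.1)) := by
  rcases Nat.eq_zero_or_pos (s + t) with h | h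
  · obtain ⟨rfl, rfl⟩ : s = 0 ∧ t = 0 := by omega
    simp [forestMass, forestMoment, tiltedMass, walkMass_zero, mul_comm]
  · have h1 := sum_mul_forestMass p f s t h
    obtain ⟨M, hM⟩ : ∃ M, s + t = M + 1 := ⟨s + t - 1, by omega⟩
    have h2 := sum_natCast_mul_tiltedMass p f M s
    have h3 := sum_mul_tiltedMass p f M s
    have h4 : ∑ kl ∈ antidiagonal s,
        p kl.1 * (f kl.1 * forestMass p kl.2 (t + kl.1) + forestMoment p f kl.2 (t + kl.1)) =
        ∑ kl ∈ antidiagonal s, f kl.1 * p kl.1 * forestMass p kl.2 (t + kl.1) +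
        (t * ∑ kl ∈ antidiagonal s, p kl.1 * tiltedMass p f M kl.2 +
        ∑ kl ∈ antidiagonal s, (kl.1 : ℝ) * p kl.1 * tiltedMass p f M kl.2) := by
      rw [Finset.mul_sum, ← Finset.sum_add_distrib, ← Finset.sum_add_distrib]
      refine Finset.sum_congr rfl fun kl hkl => ?_
      rw [mem_antidiagonal] at hkl
      have e : kl.2 + (t + kl.1) - 1 = M := by omega
      rw [forestMoment, e]
      push_cast
      ring
    have h5 : ∑ kl ∈ antidiagonal s, (kl.1 : ℝ) * (f kl.1 * p kl.1 * walkMass p (M + 1) kl.2) +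
        ∑ kl ∈ antidiagonal s, (kl.2 : ℝ) * (f kl.1 * p kl.1 * walkMass p (M + 1) kl.2) =
        s * tiltedMass p f (M + 1) s := by
      rw [← Finset.sum_add_distrib, tiltedMass, Finset.mul_sum]
      refine Finset.sum_congr rfl fun kl hkl => ?_
      rw [mem_antidiagonal] at hkl
      rw [← hkl]
      push_cast
      ring
    rw [hM] at h1
    rw [h4, h1, h3, forestMoment, show s + (t + 1) - 1 = M + 1 by omega]
    have hpos : (0 : ℝ) < (M : ℝ) + 1 := by positivity
    have hst : (s : ℝ) + t = M + 1 := by exact_mod_cast hM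
    have h6 : ∑ kl ∈ antidiagonal s, (kl.1 : ℝ) * p kl.1 * tiltedMass p f M kl.2 =
        (∑ kl ∈ antidiagonal s, (kl.2 : ℝ) * (f kl.1 * p kl.1 * walkMass p (M + 1) kl.2)) /
          ((M : ℝ) + 1) := by
      rw [eq_div_iff hpos.ne', ← h2, mul_comm]
    rw [h6]
    generalize ∑ kl ∈ antidiagonal s,
      (kl.1 : ℝ) * (f kl.1 * p kl.1 * walkMass p (M + 1) kl.2) = S₁ at h5 ⊢
    generalize ∑ kl ∈ antidiagonal s,
      (kl.2 : ℝ) * (f kl.1 * p kl.1 * walkMass p (M + 1) kl.2) = S₂ at h5 ⊢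
    push_cast
    field_simp
    linear_combination (-1 : ℝ) * h5 - (tiltedMass p f (M + 1) s) * hst

end Kemperman

/-! ### Forests and the removal of a root. -/

section Forest

open scoped ENNReal

/-- The union of the family trees rooted at the individuals of the list `L`. -/
def forest (κ : List ℕ → ℕ) (L : List (List ℕ)) : Set (List ℕ) :=
  {x | ∃ r ∈ L, ∃ u ∈ tree (fun w => κ (r ++ w)), x = r ++ u}

/-- The first `j` children of `r`. -/
def children (r : List ℕ) (j : ℕ) : List (List ℕ) := (List.range j).map fun i => r ++ [i]

/-- No member of the list is an ancestor of another one. -/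
def IsPrefixFree (L : List (List ℕ)) : Prop := L.Pairwise fun a b => ¬ a <+: b ∧ ¬ b <+: a

/-- The sum of `g` over the numbers of children of the individuals of a forest. -/
def forestSum (g : ℕ → ℝ≥0∞) (L : List (List ℕ)) (κ : List ℕ → ℕ) : ℝ≥0∞ :=
  ∑' x, (forest κ L).indicator (fun x => g (κ x)) x

lemma nil_mem_tree (κ : List ℕ → ℕ) : [] ∈ tree κ := by
  intro v j h
  simp at h

lemma cons_mem_tree_iff (κ : List ℕ → ℕ) (i : ℕ) (u : List ℕ) :
    i :: u ∈ tree κ ↔ i < κ [] ∧ u ∈ tree fun w => κ (i :: w) := by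
  constructor
  · intro h
    refine ⟨h [] i (by simp), fun v j hv => h (i :: v) j ?_⟩
    rw [List.cons_append, List.cons_prefix_cons]
    exact ⟨rfl, hv⟩
  · rintro ⟨hi, hu⟩ v j hv
    cases v with
    | nil =>
      rw [List.nil_append, List.cons_prefix_cons] at hv
      rwa [hv.1]
    | cons a v =>
      rw [List.cons_append, List.cons_prefix_cons] at hv
      obtain ⟨rfl, hv⟩ := hv
      exact hu v j hv

lemma tree_eq_forest (κ : List ℕ → ℕ) : tree κ = forest κ [[]] := by
  ext x
  simp [forest]

lemma forest_nil (κ : List ℕ → ℕ) : forest κ [] = ∅ := by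
  ext x
  simp [forest]

lemma forest_cons (κ : List ℕ → ℕ) (r : List ℕ) (L : List (List ℕ)) :
    forest κ (r :: L) = insert r (forest κ (children r (κ r) ++ L)) := by
  ext x
  simp only [forest, children, Set.mem_insert_iff, Set.mem_ofPred_eq, List.mem_append,
    List.mem_cons,    List.mem_map, List.mem_range]
  constructor
  · rintro ⟨s, rfl | hs, u, hu, rfl⟩
    · cases u with
      | nil => left; simp
      | cons i u =>
        rw [cons_mem_tree_iff] at hu
        rw [List.append_nil] at hu
        exact Or.inr ⟨s ++ [i], Or.inl ⟨i, hu.1, rfl⟩, u, by simpa using hu.2, by simp⟩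
    · exact Or.inr ⟨s, Or.inr hs, u, hu, rfl⟩
  · rintro (rfl | ⟨s, ⟨i, hi, rfl⟩ | hs, u, hu, rfl⟩)
    · exact ⟨x, Or.inl rfl, [], nil_mem_tree _, by simp⟩
    · refine ⟨r, Or.inl rfl, i :: u, (cons_mem_tree_iff _ _ _).2 ⟨by simpa using hi, ?_⟩, by simp⟩
      simpa using hu
    · exact ⟨s, Or.inr hs, u, hu, rfl⟩

lemma forest_congr {κ κ' : List ℕ → ℕ} {r : List ℕ} {L : List (List ℕ)}
    (hκ : ∀ u, u ≠ r → κ u = κ' u) (hL : ∀ w ∈ L, ¬ w <+: r) : forest κ L = forest κ' L := by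
  ext x
  unfold forest
  refine exists_congr fun s => and_congr_right fun hs => ?_
  have : (fun w => κ (s ++ w)) = fun w => κ' (s ++ w) := by
    ext w
    refine hκ _ ?_
    rintro rfl
    exact hL s hs (List.prefix_append s w)
  rw [this]

lemma notMem_forest {κ : List ℕ → ℕ} {r : List ℕ} {L : List (List ℕ)}
    (hL : ∀ w ∈ L, ¬ w <+: r) : r ∉ forest κ L := by
  rintro ⟨s, hs, u, -, rfl⟩
  exact hL s hs (List.prefix_append s u)

/-- The forest never visits `r`, so its functionals ignore `κ r`. This is the source of independence
when a root is removed. -/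
lemma forestSum_congr (g : ℕ → ℝ≥0∞) {κ κ' : List ℕ → ℕ} {r : List ℕ} {L : List (List ℕ)}
    (hκ : ∀ u, u ≠ r → κ u = κ' u) (hL : ∀ w ∈ L, ¬ w <+: r) :
    forestSum g L κ = forestSum g L κ' := by
  unfold forestSum
  rw [forest_congr hκ hL]
  refine tsum_congr fun x => ?_
  by_cases hx : x ∈ forest κ' L
  · rw [Set.indicator_of_mem hx, Set.indicator_of_mem hx, hκ x]
    rintro rfl
    exact notMem_forest hL hx
  · rw [Set.indicator_of_notMem hx, Set.indicator_of_notMem hx]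

lemma IsPrefixFree.not_prefix {r : List ℕ} {L : List (List ℕ)} (h : IsPrefixFree (r :: L)) (j : ℕ) :
    ∀ w ∈ children r j ++ L, ¬ w <+: r := by
  intro w hw hwr
  rcases List.mem_append.1 hw with hw | hw
  · obtain ⟨i, -, rfl⟩ := List.mem_map.1 hw
    have := hwr.length_le
    simp at this
  · exact ((List.pairwise_cons.1 h).1 w hw).2 hwr

lemma IsPrefixFree.children_append {r : List ℕ} {L : List (List ℕ)} (h : IsPrefixFree (r :: L))
    (j : ℕ) : IsPrefixFree (children r j ++ L) := by
  have hL := List.pairwise_cons.1 h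
  refine List.pairwise_append.2 ⟨?_, hL.2, ?_⟩
  · refine List.pairwise_map.2 (List.Pairwise.imp ?_ (List.nodup_range (n := j)))
    intro a b hab
    constructor
    · intro hp
      have := hp.eq_of_length (by simp)
      simp at this
      exact hab this
    · intro hp
      have := hp.eq_of_length (by simp)
      simp at this
      exact hab this.symm
  · intro a ha b hb
    obtain ⟨i, -, rfl⟩ := List.mem_map.1 ha
    refine ⟨fun hp => (hL.1 b hb).1 ((List.prefix_append r [i]).trans hp), fun hp => ?_⟩
    rcases List.prefix_concat_iff.1 hp with h1 | h1
    · exact (hL.1 b hb).1 (h1 ▸ List.prefix_append r [i])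
    · exact (hL.1 b hb).2 h1

lemma forestSum_nil (g : ℕ → ℝ≥0∞) (κ : List ℕ → ℕ) : forestSum g [] κ = 0 := by
  simp [forestSum, forest_nil]

/-- Prefix-freeness guarantees that `r` is not counted again in the remaining forest. -/
lemma forestSum_cons (g : ℕ → ℝ≥0∞) (κ : List ℕ → ℕ) {r : List ℕ} {L : List (List ℕ)}
    (h : IsPrefixFree (r :: L)) :
    forestSum g (r :: L) κ = g (κ r) + forestSum g (children r (κ r) ++ L) κ := by
  have hr : r ∉ forest κ (children r (κ r) ++ L) := notMem_forest (h.not_prefix _)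
  unfold forestSum
  rw [forest_cons, Set.insert_eq, Set.indicator_union_of_disjoint (by simpa using hr),
    ENNReal.tsum_add, tsum_eq_single r]
  · simp
  · intro x hx
    simp [hx]

lemma forestSum_one (L : List (List ℕ)) (κ : List ℕ → ℕ) :
    forestSum (fun _ => 1) L κ = ((forest κ L).encard : ℝ≥0∞) := by
  rw [← ENNReal.tsum_set_one, forestSum, tsum_subtype (forest κ L) fun _ => (1 : ℝ≥0∞)]

lemma measurableSet_mem_forest (L : List (List ℕ)) (x : List ℕ) :
    MeasurableSet {κ : List ℕ → ℕ | x ∈ forest κ L} := by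
  unfold forest tree
  simp only [Set.mem_ofPred_eq]
  refine measurableSet_setOfPred.2 ?_
  refine Measurable.exists fun r => Measurable.and measurable_const (Measurable.exists fun u =>
    Measurable.and (Measurable.forall fun v => Measurable.forall fun j =>
      Measurable.imp measurable_const ?_) measurable_const)
  exact measurableSet_setOfPred.1 (measurableSet_lt measurable_const (measurable_pi_apply _))

lemma measurable_forestSum (g : ℕ → ℝ≥0∞) (L : List (List ℕ)) : Measurable (forestSum g L) := by
  refine Measurable.tsum fun x => ?_
  have : (fun κ : List ℕ → ℕ => (forest κ L).indicator (fun x => g (κ x)) x) =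
      {κ : List ℕ → ℕ | x ∈ forest κ L}.indicator fun κ => g (κ x) := by
    ext κ
    classical
    rw [Set.indicator_apply, Set.indicator_apply]
    rfl
  rw [this]
  exact Measurable.indicator ((measurable_of_countable g).comp (measurable_pi_apply x))
    (measurableSet_mem_forest L x)

end Forest

/-! ### Conditioning on the number of children of one individual. -/

section Independence

open scoped ENNReal

variable {Ω : Type*} [MeasurableSpace Ω] {P : Measure Ω} [IsProbabilityMeasure P]
  {ξ : List ℕ → Ω → ℕ}

/-- Overwriting coordinate `r` with a constant leaves a function of the other coordinates; it
suffices to check finite sets of coordinates. -/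
lemma indepFun_update (hmeas : ∀ u, Measurable (ξ u)) (hindep : iIndepFun ξ P) (r : List ℕ) :
    IndepFun (ξ r) (fun ω => Function.update (fun u => ξ u ω) r 0) P := by
  have hY : ∀ u, Measurable fun ω => Function.update (fun u => ξ u ω) r 0 u := by
    intro u
    by_cases h : u = r
    · subst h
      simp
    · simp only [Function.update_of_ne h]
      exact hmeas u
  refine IndepFun.indepFun_process (Y := fun u ω => Function.update (fun u => ξ u ω) r 0 u)
    (hmeas r) hY fun I => ?_
  have h := hindep.indepFun_finset {r} (I.erase r) (by simp) hmeas
  let φ : (({r} : Finset (List ℕ)) → ℕ) → ℕ := fun y => y ⟨r, by simp⟩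
  let ψ : (↥(Finset.erase I r) → ℕ) → (I → ℕ) := fun y i =>
    if hi : (i : List ℕ) = r then 0 else y ⟨i, Finset.mem_erase.2 ⟨hi, i.2⟩⟩
  have hφ : Measurable φ := measurable_pi_apply _
  have hψ : Measurable ψ := by
    refine measurable_pi_lambda _ fun i => ?_
    by_cases hi : (i : List ℕ) = r
    · simp [ψ, hi]
    · simp only [ψ, hi, dite_false]
      exact measurable_pi_apply _
  convert! h.comp hφ hψ using 1
  ext ω i
  by_cases hi : (i : List ℕ) = r
  · simp [ψ, hi]
  · simp [ψ, hi]

lemma lintegral_eq_tsum_of_update {π : Measure ℕ} (hmeas : ∀ u, Measurable (ξ u))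
    (hindep : iIndepFun ξ P) (hlaw : ∀ u, P.map (ξ u) = π) (r : List ℕ)
    {G : ℕ → (List ℕ → ℕ) → ℝ≥0∞} (hG : ∀ j, Measurable (G j))
    (hGr : ∀ j κ, G j (Function.update κ r 0) = G j κ) :
    ∫⁻ ω, G (ξ r ω) (fun u => ξ u ω) ∂P =
      ∑' j, π {j} * ∫⁻ ω, G j (fun u => ξ u ω) ∂P := by
  have hV : Measurable fun ω => fun u => ξ u ω := measurable_pi_lambda _ hmeas
  have hU : Measurable fun ω => Function.update (fun u => ξ u ω) r 0 :=
    measurable_update_left.comp hV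
  have h1 : ∀ ω, G (ξ r ω) (fun u => ξ u ω) =
      ∑' j, ({j} : Set ℕ).indicator 1 (ξ r ω) * G j (Function.update (fun u => ξ u ω) r 0) := by
    intro ω
    rw [tsum_eq_single (ξ r ω)]
    · simp [hGr]
    · intro j hj
      simp [hj.symm]
  simp_rw [h1]
  have hm : ∀ j, Measurable fun ω => ({j} : Set ℕ).indicator (1 : ℕ → ℝ≥0∞) (ξ r ω) := fun j =>
    (measurable_of_countable (({j} : Set ℕ).indicator (1 : ℕ → ℝ≥0∞))).comp (hmeas r)
  have hGU : ∀ j, Measurable fun ω => G j (Function.update (fun u => ξ u ω) r 0) := fun j =>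
    (hG j).comp hU
  rw [lintegral_tsum fun j => ((hm j).fun_mul (hGU j)).aemeasurable]
  refine tsum_congr fun j => ?_
  have h2 : IndepFun (fun ω => ({j} : Set ℕ).indicator (1 : ℕ → ℝ≥0∞) (ξ r ω))
      (fun ω => G j (Function.update (fun u => ξ u ω) r 0)) P :=
    (indepFun_update hmeas hindep r).comp
      (measurable_of_countable (({j} : Set ℕ).indicator (1 : ℕ → ℝ≥0∞))) (hG j)
  have h3 := lintegral_mul_eq_lintegral_mul_lintegral_of_indepFun (hm j) (hGU j) h2
  simp only [Pi.mul_apply] at h3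
  rw [h3]
  congr 1
  · rw [← hlaw r, Measure.map_apply (hmeas r) (measurableSet_singleton j),
      ← lintegral_indicator_one (hmeas r (measurableSet_singleton j))]
    rfl
  · simp_rw [hGr]

end Independence

/-! ### The law of the size of a forest, and its additive functionals. -/

section ForestLaw

open scoped ENNReal
open Finset.HasAntidiagonal

lemma tiltedMass_nonneg {p f : ℕ → ℝ} (hp : ∀ k, 0 ≤ p k) (hf : ∀ k, 0 ≤ f k) (n s : ℕ) :
    0 ≤ tiltedMass p f n s :=
  Finset.sum_nonneg fun _ _ => mul_nonneg (mul_nonneg (hf _) (hp _)) (walkMass_nonneg hp _ _)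

lemma forestMass_nonneg {p : ℕ → ℝ} (hp : ∀ k, 0 ≤ p k) (l k : ℕ) : 0 ≤ forestMass p l k := by
  unfold forestMass
  split_ifs
  · exact zero_le_one
  · exact mul_nonneg (by positivity) (walkMass_nonneg hp _ _)

lemma forestMoment_nonneg {p f : ℕ → ℝ} (hp : ∀ k, 0 ≤ p k) (hf : ∀ k, 0 ≤ f k) (l k : ℕ) :
    0 ≤ forestMoment p f l k :=
  mul_nonneg (Nat.cast_nonneg k) (tiltedMass_nonneg hp hf _ _)

lemma tsum_ofReal_mul_ite {p : ℕ → ℝ} (hp : ∀ k, 0 ≤ p k) {H : ℕ → ℕ → ℝ} (hH : ∀ j l, 0 ≤ H j l)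
    (n t : ℕ) :
    ∑' j, ENNReal.ofReal (p j) * ENNReal.ofReal (if t + j ≤ n then H j (n - (t + j)) else 0) =
      ENNReal.ofReal (if t ≤ n then ∑ kl ∈ antidiagonal (n - t), p kl.1 * H kl.1 kl.2 else 0) := by
  split_ifs with ht
  · rw [tsum_eq_sum (s := Finset.range (n - t + 1)),
      Finset.Nat.sum_antidiagonal_eq_sum_range_succ_mk,
      ENNReal.ofReal_sum_of_nonneg fun j _ => mul_nonneg (hp _) (hH _ _)]
    · refine Finset.sum_congr rfl fun j hj => ?_
      rw [Finset.mem_range] at hj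
      rw [if_pos (by omega), ENNReal.ofReal_mul (hp j), Nat.sub_sub]
    · intro j hj
      rw [Finset.mem_range] at hj
      rw [if_neg (by omega), ENNReal.ofReal_zero, mul_zero]
  · rw [ENNReal.ofReal_zero, ENNReal.tsum_eq_zero]
    intro j
    rw [if_neg (by omega), ENNReal.ofReal_zero, mul_zero]

lemma length_children_append (r : List ℕ) (j : ℕ) (L : List (List ℕ)) :
    (children r j ++ L).length = L.length + j := by
  simp [children, add_comm]

variable {Ω : Type*} [MeasurableSpace Ω] {P : Measure Ω} [IsProbabilityMeasure P]
  {ξ : List ℕ → Ω → ℕ} {π : Measure ℕ}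

/-- The one-step decomposition at the first root. The free `Ψ` serves the size law (`1`), additive
functionals (`f j + x`) and functions of the root alone (`f j`). -/
lemma lintegral_forest_cons (hmeas : ∀ u, Measurable (ξ u))
    (hindep : iIndepFun ξ P) (hlaw : ∀ u, P.map (ξ u) = π) (g : ℕ → ℝ≥0∞)
    {Ψ : ℕ → ℝ≥0∞ → ℝ≥0∞} (hΨ : ∀ j, Measurable (Ψ j)) {r : List ℕ} {L : List (List ℕ)}
    (h : IsPrefixFree (r :: L)) (n : ℕ) :
    ∫⁻ ω, (if forestSum (fun _ => 1) (r :: L) (fun u => ξ u ω) = ((n + 1 : ℕ) : ℝ≥0∞) then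
        Ψ (ξ r ω) (forestSum g (children r (ξ r ω) ++ L) fun u => ξ u ω) else 0) ∂P =
      ∑' j, π {j} * ∫⁻ ω, (if forestSum (fun _ => 1) (children r j ++ L) (fun u => ξ u ω) = n then
        Ψ j (forestSum g (children r j ++ L) fun u => ξ u ω) else 0) ∂P := by
  rw [← lintegral_eq_tsum_of_update hmeas hindep hlaw r (G := fun j κ =>
    if forestSum (fun _ => 1) (children r j ++ L) κ = n then
      Ψ j (forestSum g (children r j ++ L) κ) else 0)]
  · refine lintegral_congr fun ω => ?_
    have hiff : forestSum (fun _ => 1) (r :: L) (fun u => ξ u ω) = ((n + 1 : ℕ) : ℝ≥0∞) ↔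
        forestSum (fun _ => 1) (children r (ξ r ω) ++ L) (fun u => ξ u ω) = n := by
      rw [forestSum_cons _ _ h, Nat.cast_add, Nat.cast_one, add_comm (n : ℝ≥0∞),
        ENNReal.add_right_inj ENNReal.one_ne_top]
    simp only [hiff]
  · intro j
    exact Measurable.ite (measurable_forestSum _ _ (measurableSet_singleton _))
      ((hΨ j).comp (measurable_forestSum _ _)) measurable_const
  · intro j κ
    have hκ : ∀ u, u ≠ r → Function.update κ r 0 u = κ u := fun u hu => Function.update_of_ne hu _ _
    simp only [forestSum_congr _ hκ (h.not_prefix j)]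

variable [IsProbabilityMeasure π]

/-- Induction on the number of vertices, for all prefix-free lists at once, since removing a root
changes the list. -/
lemma lintegral_forest_size_eq (hmeas : ∀ u, Measurable (ξ u))
    (hindep : iIndepFun ξ P) (hlaw : ∀ u, P.map (ξ u) = π) (n : ℕ) {L : List (List ℕ)}
    (hL : IsPrefixFree L) :
    ∫⁻ ω, (if forestSum (fun _ => 1) L (fun u => ξ u ω) = n then 1 else 0) ∂P =
      ENNReal.ofReal (if L.length ≤ n then
        forestMass (fun k => π.real {k}) (n - L.length) L.length else 0) := by
  have hp : ∀ k, 0 ≤ π.real {k} := fun _ => measureReal_nonneg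
  induction n generalizing L with
  | zero =>
    cases L with
    | nil => simp [forestSum_nil, forestMass]
    | cons r L => simp [forestSum_cons _ _ hL]
  | succ n ih =>
    cases L with
    | nil =>
      have : (0 : ℝ≥0∞) ≠ (n : ℝ≥0∞) + 1 := (by positivity : (0 : ℝ≥0∞) < (n : ℝ≥0∞) + 1).ne
      simp [forestSum_nil, forestMass, this]
    | cons r L =>
      have h := lintegral_forest_cons hmeas hindep hlaw (fun _ => 0) (Ψ := fun _ _ => 1)
        (fun _ => measurable_const) hL n
      rw [h]
      simp only [List.length_cons, Nat.add_le_add_iff_right, Nat.add_sub_add_right]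
      rw [forestMass_succ, ← tsum_ofReal_mul_ite hp
        (H := fun j l => forestMass (fun k => π.real {k}) l (L.length + j))
        (fun j l => forestMass_nonneg hp _ _)]
      refine tsum_congr fun j => ?_
      rw [ih (hL.children_append j), length_children_append, ofReal_measureReal]

lemma lintegral_forestSum_eq (hmeas : ∀ u, Measurable (ξ u))
    (hindep : iIndepFun ξ P) (hlaw : ∀ u, P.map (ξ u) = π) {f : ℕ → ℝ} (hf : ∀ k, 0 ≤ f k)
    (n : ℕ) {L : List (List ℕ)} (hL : IsPrefixFree L) :
    ∫⁻ ω, (if forestSum (fun _ => 1) L (fun u => ξ u ω) = n then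
        forestSum (fun k => ENNReal.ofReal (f k)) L (fun u => ξ u ω) else 0) ∂P =
      ENNReal.ofReal (if L.length ≤ n then
        forestMoment (fun k => π.real {k}) f (n - L.length) L.length else 0) := by
  have hp : ∀ k, 0 ≤ π.real {k} := fun _ => measureReal_nonneg
  induction n generalizing L with
  | zero =>
    cases L with
    | nil => simp [forestSum_nil, forestMoment]
    | cons r L => simp [forestSum_cons _ _ hL]
  | succ n ih =>
    cases L with
    | nil => simp [forestSum_nil, forestMoment]
    | cons r L =>
      have h := lintegral_forest_cons hmeas hindep hlaw (fun k => ENNReal.ofReal (f k))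
        (Ψ := fun j x => ENNReal.ofReal (f j) + x) (fun _ => by fun_prop) hL n
      have hc : ∀ ω, ENNReal.ofReal (f (ξ r ω)) + forestSum (fun k => ENNReal.ofReal (f k))
          (children r (ξ r ω) ++ L) (fun u => ξ u ω) =
          forestSum (fun k => ENNReal.ofReal (f k)) (r :: L) (fun u => ξ u ω) :=
        fun ω => (forestSum_cons (fun k => ENNReal.ofReal (f k)) (fun u => ξ u ω) hL).symm
      simp only [hc] at h
      rw [h]
      simp only [List.length_cons, Nat.add_le_add_iff_right, Nat.add_sub_add_right]
      rw [forestMoment_succ, ← tsum_ofReal_mul_ite hp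
        (H := fun j l => f j * forestMass (fun k => π.real {k}) l (L.length + j) +
          forestMoment (fun k => π.real {k}) f l (L.length + j))
        (fun j l => add_nonneg (mul_nonneg (hf j) (forestMass_nonneg hp _ _))
          (forestMoment_nonneg hp hf _ _))]
      refine tsum_congr fun j => ?_
      rw [ofReal_measureReal]
      congr 1
      have hm : Measurable fun ω => fun u => ξ u ω := measurable_pi_lambda _ hmeas
      have hs : MeasurableSet {ω | forestSum (fun _ => 1) (children r j ++ L) (fun u => ξ u ω) =
          (n : ℝ≥0∞)} := ((measurable_forestSum _ _).comp hm) (measurableSet_singleton _)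
      have hsplit : ∀ ω, (if forestSum (fun _ => 1) (children r j ++ L) (fun u => ξ u ω) =
            (n : ℝ≥0∞) then ENNReal.ofReal (f j) +
              forestSum (fun k => ENNReal.ofReal (f k)) (children r j ++ L) (fun u => ξ u ω)
            else 0) =
          ENNReal.ofReal (f j) *
            (if forestSum (fun _ => 1) (children r j ++ L) (fun u => ξ u ω) = (n : ℝ≥0∞)
              then 1 else 0) +
          (if forestSum (fun _ => 1) (children r j ++ L) (fun u => ξ u ω) = (n : ℝ≥0∞) then
            forestSum (fun k => ENNReal.ofReal (f k)) (children r j ++ L) (fun u => ξ u ω)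
            else 0) := by
        intro ω
        split_ifs <;> simp
      have hm1 : Measurable fun ω => (if forestSum (fun _ => 1) (children r j ++ L)
          (fun u => ξ u ω) = (n : ℝ≥0∞) then (1 : ℝ≥0∞) else 0) :=
        Measurable.ite hs measurable_const measurable_const
      simp_rw [hsplit]
      rw [lintegral_add_left (hm1.const_mul _), lintegral_const_mul _ hm1,
        lintegral_forest_size_eq hmeas hindep hlaw n (hL.children_append j),
        ih (hL.children_append j), length_children_append, ← ENNReal.ofReal_mul (hf j)]
      split_ifs
      · rw [ENNReal.ofReal_add (mul_nonneg (hf j) (forestMass_nonneg hp _ _))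
          (forestMoment_nonneg hp hf _ _)]
      · simp

lemma isPrefixFree_singleton (r : List ℕ) : IsPrefixFree [r] := List.pairwise_singleton _ _

lemma mem_sizeEvent_iff {Ω : Type*} {ξ : List ℕ → Ω → ℕ} (n : ℕ) (ω : Ω) :
    ω ∈ sizeEvent ξ n ↔ forestSum (fun _ => 1) [[]] (fun u => ξ u ω) = (n : ℝ≥0∞) := by
  rw [forestSum_one, ← tree_eq_forest, ← ENat.toENNReal_coe, ENat.toENNReal_inj]
  rfl

lemma measurableSet_sizeEvent (hmeas : ∀ u, Measurable (ξ u)) (n : ℕ) :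
    MeasurableSet (sizeEvent ξ n) := by
  have : sizeEvent ξ n =
      {ω | forestSum (fun _ => 1) [[]] (fun u => ξ u ω) = (n : ℝ≥0∞)} := by
    ext ω
    exact mem_sizeEvent_iff n ω
  rw [this]
  exact ((measurable_forestSum _ _).comp (measurable_pi_lambda _ hmeas)) (measurableSet_singleton _)

/-- The Otter-Dwass formula. -/
lemma measure_sizeEvent (hmeas : ∀ u, Measurable (ξ u))
    (hindep : iIndepFun ξ P) (hlaw : ∀ u, P.map (ξ u) = π) (n : ℕ) :
    P (sizeEvent ξ (n + 1)) =
      ENNReal.ofReal (walkMass (fun k => π.real {k}) (n + 1) n / (n + 1)) := by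
  have h := lintegral_forest_size_eq hmeas hindep hlaw (n + 1) (isPrefixFree_singleton [])
  classical
  simp_rw [← mem_sizeEvent_iff (ξ := ξ)] at h
  have h2 : ∀ ω, (if ω ∈ sizeEvent ξ (n + 1) then (1 : ℝ≥0∞) else 0) =
      (sizeEvent ξ (n + 1)).indicator 1 ω := fun ω => by
    classical
    rw [Set.indicator_apply]
    rfl
  simp_rw [h2] at h
  rw [lintegral_indicator_one (measurableSet_sizeEvent hmeas _)] at h
  rw [h]
  simp [forestMass]
  ring_nf

lemma setLIntegral_forestSum (hmeas : ∀ u, Measurable (ξ u))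
    (hindep : iIndepFun ξ P) (hlaw : ∀ u, P.map (ξ u) = π) {f : ℕ → ℝ} (hf : ∀ k, 0 ≤ f k)
    (n : ℕ) :
    ∫⁻ ω in sizeEvent ξ (n + 1),
        forestSum (fun k => ENNReal.ofReal (f k)) [[]] (fun u => ξ u ω) ∂P =
      ENNReal.ofReal (tiltedMass (fun k => π.real {k}) f n n) := by
  have h := lintegral_forestSum_eq hmeas hindep hlaw hf (n + 1) (isPrefixFree_singleton [])
  classical
  simp_rw [← mem_sizeEvent_iff (ξ := ξ)] at h
  rw [← lintegral_indicator (measurableSet_sizeEvent hmeas _)]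
  classical
  simp_rw [Set.indicator_apply]
  rw [h]
  simp [forestMoment]

/-- Given `k` children of the root, the other `n` vertices form a forest of `k` trees, of
probability `(k/n) W_n(n-k)`. The factor `k/n` makes the root negligible in the limit. -/
lemma setLIntegral_root (hmeas : ∀ u, Measurable (ξ u))
    (hindep : iIndepFun ξ P) (hlaw : ∀ u, P.map (ξ u) = π) {f : ℕ → ℝ} (hf : ∀ k, 0 ≤ f k)
    {n : ℕ} (hn : 0 < n) :
    ∫⁻ ω in sizeEvent ξ (n + 1), ENNReal.ofReal (f (ξ [] ω)) ∂P =
      ENNReal.ofReal (tiltedMass (fun k => π.real {k}) (fun k => f k * k / n) n n) := by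
  have hp : ∀ k, 0 ≤ π.real {k} := fun _ => measureReal_nonneg
  have h := lintegral_forest_cons hmeas hindep hlaw (fun _ => 0)
    (Ψ := fun j _ => ENNReal.ofReal (f j)) (fun _ => measurable_const) (isPrefixFree_singleton []) n
  classical
  simp_rw [← mem_sizeEvent_iff (ξ := ξ)] at h
  rw [← lintegral_indicator (measurableSet_sizeEvent hmeas _)]
  classical
  simp_rw [Set.indicator_apply]
  rw [h]
  have h1 := tsum_ofReal_mul_ite hp
        (H := fun j l => f j * forestMass (fun k => π.real {k}) l j)
        (fun j l => mul_nonneg (hf j) (forestMass_nonneg hp _ _)) n 0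
  simp only [zero_add, Nat.zero_le, if_true, Nat.sub_zero] at h1
  have h2 : tiltedMass (fun k => π.real {k}) (fun k => f k * k / n) n n =
      ∑ kl ∈ antidiagonal n, π.real {kl.1} * (f kl.1 * forestMass (fun k => π.real {k}) kl.2 kl.1)
      := by
    refine Finset.sum_congr rfl fun kl hkl => ?_
    rw [mem_antidiagonal] at hkl
    rw [forestMass, add_comm kl.2, hkl, if_neg hn.ne']
    ring
  rw [h2, ← h1]
  refine tsum_congr fun j => ?_
  rw [ofReal_measureReal]
  congr 1
  have h3 := lintegral_forest_size_eq hmeas hindep hlaw n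
    ((isPrefixFree_singleton []).children_append j)
  have hs : MeasurableSet {ω | forestSum (fun _ => 1) (children [] j ++ []) (fun u => ξ u ω) =
      (n : ℝ≥0∞)} := ((measurable_forestSum _ _).comp (measurable_pi_lambda _ hmeas))
        (measurableSet_singleton _)
  have hm1 : Measurable fun ω => (if forestSum (fun _ => 1) (children [] j ++ [])
      (fun u => ξ u ω) = (n : ℝ≥0∞) then (1 : ℝ≥0∞) else 0) :=
    Measurable.ite hs measurable_const measurable_const
  rw [length_children_append, List.length_nil, zero_add] at h3
  have h4 : ENNReal.ofReal (if j ≤ n then f j * forestMass (fun k => π.real {k}) (n - j) j else 0) =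
      ENNReal.ofReal (f j) *
        ENNReal.ofReal (if j ≤ n then forestMass (fun k => π.real {k}) (n - j) j else 0) := by
    rw [← ENNReal.ofReal_mul (hf j)]
    split_ifs <;> simp
  rw [h4, ← h3, ← lintegral_const_mul _ hm1]
  refine lintegral_congr fun ω => ?_
  split_ifs <;> simp

end ForestLaw

/-! ### Degrees in terms of numbers of children. -/

section Degree

open scoped ENNReal

lemma append_singleton_mem_tree_iff {κ : List ℕ → ℕ} {x : List ℕ} (hx : x ∈ tree κ) (j : ℕ) :
    x ++ [j] ∈ tree κ ↔ j < κ x := by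
  refine ⟨fun h => h x j (List.prefix_refl _), fun h v i hv => ?_⟩
  rcases List.prefix_concat_iff.1 hv with h1 | h1
  · obtain ⟨rfl, h2⟩ := List.append_inj' h1 rfl
    rw [List.cons.injEq] at h2
    rwa [h2.1]
  · exact hx v i h1

lemma mem_tree_of_prefix {κ : List ℕ → ℕ} {x y : List ℕ} (hx : x ∈ tree κ) (hy : y <+: x) :
    y ∈ tree κ := fun v j hv => hx v j (hv.trans hy)

lemma degree_tree {κ : List ℕ → ℕ} {x : List ℕ} (hx : x ∈ tree κ) :
    degree (tree κ) x = if x = [] then κ x else κ x + 1 := by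
  have hinj : Function.Injective fun j : ℕ => x ++ [j] := by
    intro a b hab
    simpa using hab
  have hchild : ((fun j : ℕ => x ++ [j]) '' Set.Iio (κ x)).ncard = κ x := by
    rw [Set.ncard_image_of_injective _ hinj, ← Finset.coe_Iio, Set.ncard_coe_finset, Nat.card_Iio]
  split_ifs with h0
  · subst h0
    rw [degree, ← hchild]
    congr 1
    ext y
    simp only [Set.mem_ofPred_eq, parentGraph, Set.mem_image, Set.mem_Iio]
    constructor
    · rintro ⟨hy, ⟨j, rfl⟩ | ⟨j, hj⟩⟩
      · exact ⟨j, (append_singleton_mem_tree_iff hx j).1 hy, rfl⟩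
      · simp at hj
    · rintro ⟨j, hj, rfl⟩
      exact ⟨(append_singleton_mem_tree_iff hx j).2 hj, Or.inl ⟨j, rfl⟩⟩
  · obtain ⟨z, i, rfl⟩ := (List.eq_nil_or_concat x).resolve_left h0
    rw [List.concat_eq_append] at hx hinj hchild ⊢
    have hset : {y | y ∈ tree κ ∧ parentGraph.Adj (z ++ [i]) y} =
        insert z ((fun j : ℕ => (z ++ [i]) ++ [j]) '' Set.Iio (κ (z ++ [i]))) := by
      ext y
      simp only [Set.mem_ofPred_eq, parentGraph, Set.mem_insert_iff, Set.mem_image, Set.mem_Iio]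
      constructor
      · rintro ⟨hy, ⟨j, rfl⟩ | ⟨j, hj⟩⟩
        · exact Or.inr ⟨j, (append_singleton_mem_tree_iff hx j).1 hy, rfl⟩
        · exact Or.inl (List.append_inj' hj rfl).1.symm
      · rintro (rfl | ⟨j, hj, rfl⟩)
        · exact ⟨mem_tree_of_prefix hx (List.prefix_append _ _), Or.inr ⟨i, rfl⟩⟩
        · exact ⟨(append_singleton_mem_tree_iff hx j).2 hj, Or.inl ⟨j, rfl⟩⟩
    rw [degree, hset, Set.ncard_insert_of_notMem _ ((Set.finite_Iio _).image _), hchild]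
    rintro ⟨j, -, hj⟩
    simpa using congrArg List.length hj

/-- The contribution of a vertex of degree `m` to the truncated degree moment. -/
def truncatedPow (q : ℝ) (k₀ m : ℕ) : ℝ := if k₀ ≤ m then (m : ℝ) ^ q else 0

lemma truncatedPow_nonneg (q : ℝ) (k₀ m : ℕ) : 0 ≤ truncatedPow q k₀ m := by
  unfold truncatedPow
  split_ifs <;> positivity

lemma truncatedPow_le {q : ℝ} (hq : 0 ≤ q) (k₀ : ℕ) {m k : ℕ} (hmk : m ≤ k + 1) :
    truncatedPow q k₀ m ≤ ((k : ℝ) + 1) ^ q := by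
  unfold truncatedPow
  split_ifs
  · gcongr
    exact_mod_cast hmk
  · positivity

/-- Only the root has no parent; the last bracket corrects its term after all vertices have been
given degree `κ x + 1`. -/
lemma truncatedDegreeMoment_tree (q : ℝ) (k₀ : ℕ) {κ : List ℕ → ℕ} (hκ : (tree κ).Finite) :
    truncatedDegreeMoment q k₀ (tree κ) =
      (forestSum (fun k => ENNReal.ofReal (truncatedPow q k₀ (k + 1))) [[]] κ).toReal +
        (truncatedPow q k₀ (κ []) - truncatedPow q k₀ (κ [] + 1)) := by
  have h1 : truncatedDegreeMoment q k₀ (tree κ) =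
      ∑ x ∈ hκ.toFinset, truncatedPow q k₀ (degree (tree κ) x) :=
    finsum_mem_eq_finite_toFinset_sum _ hκ
  have h2 : forestSum (fun k => ENNReal.ofReal (truncatedPow q k₀ (k + 1))) [[]] κ =
      ∑ x ∈ hκ.toFinset, ENNReal.ofReal (truncatedPow q k₀ (κ x + 1)) := by
    rw [forestSum, ← tree_eq_forest, tsum_eq_sum (s := hκ.toFinset)]
    · refine Finset.sum_congr rfl fun x hx => ?_
      rw [Set.indicator_of_mem (hκ.mem_toFinset.1 hx)]
    · intro x hx
      rw [Set.indicator_of_notMem fun h => hx (hκ.mem_toFinset.2 h)]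
  have hnil : [] ∈ hκ.toFinset := hκ.mem_toFinset.2 (nil_mem_tree κ)
  rw [h1, h2, ENNReal.toReal_sum fun _ _ => ENNReal.ofReal_ne_top,
    ← Finset.add_sum_erase _ _ hnil, ← Finset.add_sum_erase _ _ hnil, degree_tree (nil_mem_tree κ),
    if_pos rfl, ENNReal.toReal_ofReal (truncatedPow_nonneg _ _ _)]
  have h3 : ∑ x ∈ hκ.toFinset.erase [], truncatedPow q k₀ (degree (tree κ) x) =
      ∑ x ∈ hκ.toFinset.erase [], (ENNReal.ofReal (truncatedPow q k₀ (κ x + 1))).toReal := by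
    refine Finset.sum_congr rfl fun x hx => ?_
    rw [Finset.mem_erase, hκ.mem_toFinset] at hx
    rw [degree_tree hx.2, if_neg hx.1, ENNReal.toReal_ofReal (truncatedPow_nonneg _ _ _)]
  rw [h3]
  ring

lemma tree_finite_of_mem_sizeEvent {Ω : Type*} {ξ : List ℕ → Ω → ℕ} {n : ℕ} {ω : Ω}
    (hω : ω ∈ sizeEvent ξ n) : (tree fun u => ξ u ω).Finite :=
  Set.finite_of_encard_eq_coe hω

end Degree

/-! ### Ratios of walk probabilities and dominated convergence. -/

section Ratio

open Finset.HasAntidiagonal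

variable {π : Measure ℕ}

lemma tendsto_period_mul (hmean : HasSum (fun k : ℕ => (k : ℝ) * π.real {k}) 1) :
    Tendsto (fun m : ℕ => period π * m) atTop atTop :=
  tendsto_id.const_mul_atTop' (period_pos hmean)

variable [IsProbabilityMeasure π]

lemma eventually_walkMass_pos (hmean : HasSum (fun k : ℕ => (k : ℝ) * π.real {k}) 1)
    (hone : π.real {1} < 1) (hvar : Summable fun k : ℕ => (k : ℝ) ^ 2 * π.real {k}) :
    ∀ᶠ m : ℕ in atTop, 0 < walkMass (fun k => π.real {k}) (period π * m + 1) (period π * m) := by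
  obtain ⟨γ, hγ, hlim⟩ := exists_tendsto_sqrt_mul_walkMass hmean hone hvar
  have h := hlim (fun m => period π * m + 1) (fun m => period π * m) 1
    ((tendsto_add_atTop_nat 1).comp (tendsto_period_mul hmean))
    (Eventually.of_forall fun m => ⟨by push_cast; ring, dvd_mul_right _ _⟩)
  filter_upwards [h.eventually (lt_mem_nhds hγ)] with m hm
  exact pos_of_mul_pos_right hm (Real.sqrt_nonneg _)

lemma exists_walkMass_ratio (hmean : HasSum (fun k : ℕ => (k : ℝ) * π.real {k}) 1)
    (hone : π.real {1} < 1) (hvar : Summable fun k : ℕ => (k : ℝ) ^ 2 * π.real {k}) :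
    (∃ C, ∀ᶠ m : ℕ in atTop, ∀ j, walkMass (fun k => π.real {k}) (period π * m) j /
      walkMass (fun k => π.real {k}) (period π * m + 1) (period π * m) ≤ C) ∧
    ∀ k, period π ∣ k → Tendsto (fun m : ℕ =>
      walkMass (fun k => π.real {k}) (period π * m) (period π * m - k) /
        walkMass (fun k => π.real {k}) (period π * m + 1) (period π * m)) atTop (𝓝 1) := by
  obtain ⟨γ, hγ, hlim⟩ := exists_tendsto_sqrt_mul_walkMass hmean hone hvar
  obtain ⟨C, hC⟩ := exists_sqrt_mul_walkMass_le hmean hone hvar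
  have hN := tendsto_period_mul hmean
  have h := hlim (fun m => period π * m + 1) (fun m => period π * m) 1
    ((tendsto_add_atTop_nat 1).comp hN)
    (Eventually.of_forall fun m => ⟨by push_cast; ring, dvd_mul_right _ _⟩)
  have hr : Tendsto (fun m : ℕ => √((period π * m + 1 : ℕ) : ℝ) / √((period π * m : ℕ) : ℝ)) atTop
      (𝓝 1) := by
    have h1 : Tendsto (fun n : ℕ => √(1 + 1 / (n : ℝ))) atTop (𝓝 1) := by
      have h2 : Tendsto (fun n : ℕ => 1 + 1 / (n : ℝ)) atTop (𝓝 1) := by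
        simpa using (tendsto_const_nhds (x := (1 : ℝ))).add tendsto_one_div_atTop_nhds_zero_nat
      have h3 := (Real.continuous_sqrt.tendsto 1).comp h2
      rwa [Real.sqrt_one] at h3
    refine (h1.comp hN).congr' ?_
    filter_upwards [hN.eventually_gt_atTop 0] with m hm
    have hm' : (0 : ℝ) < ((period π * m : ℕ) : ℝ) := by exact_mod_cast hm
    rw [Function.comp, ← Real.sqrt_div (by positivity)]
    congr 1
    push_cast at hm' ⊢
    rw [add_div, div_self hm'.ne']
  -- Splits the ratio into a rescaled numerator, covered by the uniform bound or the local limit,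
  -- and a factor independent of `j` that tends to `1/γ`.
  have hfac : ∀ᶠ m : ℕ in atTop, ∀ j, walkMass (fun k => π.real {k}) (period π * m) j /
      walkMass (fun k => π.real {k}) (period π * m + 1) (period π * m) =
      √((period π * m : ℕ) : ℝ) * walkMass (fun k => π.real {k}) (period π * m) j *
        ((√((period π * m + 1 : ℕ) : ℝ) / √((period π * m : ℕ) : ℝ)) /
        (√((period π * m + 1 : ℕ) : ℝ) *
          walkMass (fun k => π.real {k}) (period π * m + 1) (period π * m))) := by
    filter_upwards [hN.eventually_gt_atTop 0, eventually_walkMass_pos hmean hone hvar]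
      with m hm hw j
    have h1 : 0 < √((period π * m : ℕ) : ℝ) := Real.sqrt_pos.2 (by exact_mod_cast hm)
    have h2 : 0 < √((period π * m + 1 : ℕ) : ℝ) := Real.sqrt_pos.2 (by positivity)
    field_simp
  have hfac2 := hr.div h hγ.ne'
  constructor
  · have hpos : 0 < 1 / γ + 1 := by positivity
    refine ⟨C * (1 / γ + 1), ?_⟩
    filter_upwards [hfac, hfac2.eventually (gt_mem_nhds (lt_add_one (1 / γ)))] with m hm hm2 j
    rw [hm]
    have hC0 : 0 ≤ C := le_trans (by simp) (hC 0 0)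
    refine mul_le_mul (hC _ _) hm2.le ?_ hC0
    exact div_nonneg (by positivity) (mul_nonneg (Real.sqrt_nonneg _)
      (walkMass_nonneg (fun _ => measureReal_nonneg) _ _))
  · intro k hk
    have h1 := hlim (fun m => period π * m) (fun m => period π * m - k) k hN (by
      filter_upwards [hN.eventually_ge_atTop k] with m hm
      exact ⟨by rw [Nat.cast_sub hm]; ring, Nat.dvd_sub (dvd_mul_right _ _) hk⟩)
    have h2 := h1.mul hfac2
    rw [mul_one_div_cancel hγ.ne'] at h2
    refine h2.congr' ?_
    filter_upwards [hfac] with m hm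
    exact (hm _).symm

/-- Allowing `F` to vary with `m`, and bounding it only for `k ≤ d m`, lets one statement treat both
the main term and the root error. -/
lemma tendsto_tiltedMass_div (hmean : HasSum (fun k : ℕ => (k : ℝ) * π.real {k}) 1)
    (hone : π.real {1} < 1) (hvar : Summable fun k : ℕ => (k : ℝ) ^ 2 * π.real {k})
    {F : ℕ → ℕ → ℝ} {f b : ℕ → ℝ} (hb : Summable fun k => b k * π.real {k})
    (hF0 : ∀ m k, 0 ≤ F m k) (hFb : ∀ m k, k ≤ period π * m → F m k ≤ b k)
    (hFf : ∀ k, Tendsto (fun m => F m k) atTop (𝓝 (f k))) :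
    Tendsto (fun m : ℕ =>
      tiltedMass (fun k => π.real {k}) (F m) (period π * m) (period π * m) /
        walkMass (fun k => π.real {k}) (period π * m + 1) (period π * m)) atTop
      (𝓝 (∑' k, f k * π.real {k})) := by
  obtain ⟨⟨C, hC⟩, hlim⟩ := exists_walkMass_ratio hmean hone hvar
  have hp : ∀ k, 0 ≤ π.real {k} := fun _ => measureReal_nonneg
  have hN := tendsto_period_mul hmean
  have heq : ∀ m : ℕ, tiltedMass (fun k => π.real {k}) (F m) (period π * m) (period π * m) /
        walkMass (fun k => π.real {k}) (period π * m + 1) (period π * m) =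
      ∑' k, if k ≤ period π * m then F m k * π.real {k} *
        (walkMass (fun k => π.real {k}) (period π * m) (period π * m - k) /
        walkMass (fun k => π.real {k}) (period π * m + 1) (period π * m)) else 0 := by
    intro m
    rw [tiltedMass, Finset.Nat.sum_antidiagonal_eq_sum_range_succ_mk, Finset.sum_div,
      tsum_eq_sum (s := Finset.range (period π * m + 1))]
    · refine Finset.sum_congr rfl fun k hk => ?_
      rw [if_pos (Nat.lt_succ_iff.1 (Finset.mem_range.1 hk)), mul_div_assoc]
    · intro k hk
      rw [if_neg fun h => hk (Finset.mem_range.2 (Nat.lt_succ_of_le h))]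
  simp_rw [heq]
  refine tendsto_tsum_of_dominated_convergence (bound := fun k => |b k * π.real {k} * C|)
    (hb.mul_right C).abs (fun k => ?_) ?_
  -- The ratio is only known to converge when `d ∣ k`; uncharged `k` contribute nothing.
  · by_cases hk : π.real {k} = 0
    · simp [hk]
    · have h1 := ((hFf k).mul_const (π.real {k})).mul (hlim k (period_dvd hmean hk))
      rw [mul_one] at h1
      refine h1.congr' ?_
      filter_upwards [hN.eventually_ge_atTop k] with m hm
      rw [if_pos hm]
  · filter_upwards [hC] with m hm k
    split_ifs with hk
    · have hw : 0 ≤ walkMass (fun k => π.real {k}) (period π * m) (period π * m - k) /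
        walkMass (fun k => π.real {k}) (period π * m + 1) (period π * m) :=
        div_nonneg (walkMass_nonneg hp _ _) (walkMass_nonneg hp _ _)
      rw [Real.norm_of_nonneg (mul_nonneg (mul_nonneg (hF0 _ _) (hp k)) hw)]
      refine le_trans ?_ (le_abs_self _)
      have hb0 : 0 ≤ b k := (hF0 m k).trans (hFb m k hk)
      exact mul_le_mul (mul_le_mul_of_nonneg_right (hFb m k hk) (hp k)) (hm _) hw
        (mul_nonneg hb0 (hp k))
    · rw [norm_zero]
      exact abs_nonneg _

lemma summable_succ_rpow_mul {q : ℝ} (hq : 0 ≤ q)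
    (hmoment : Summable fun k : ℕ => (k : ℝ) ^ q * π.real {k}) :
    Summable fun k : ℕ => ((k : ℝ) + 1) ^ q * π.real {k} := by
  refine Summable.of_nonneg_of_le (fun k => by positivity) (fun k => ?_)
    ((hmoment.add (hasSum_mass π).summable).mul_left (2 ^ q))
  rw [← add_one_mul, ← mul_assoc]
  refine mul_le_mul_of_nonneg_right ?_ measureReal_nonneg
  rcases Nat.eq_zero_or_pos k with rfl | hk
  · have h1 := Real.one_le_rpow (x := 2) (by norm_num) hq
    have h2 : (0 : ℝ) ≤ (0 : ℝ) ^ q := by positivity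
    simp only [Nat.cast_zero, zero_add, Real.one_rpow]
    nlinarith
  · have h1 : (1 : ℝ) ≤ k := by exact_mod_cast hk
    calc ((k : ℝ) + 1) ^ q ≤ (2 * k) ^ q := by gcongr; linarith
      _ = 2 ^ q * (k : ℝ) ^ q := Real.mul_rpow (by norm_num) (by positivity)
      _ ≤ 2 ^ q * ((k : ℝ) ^ q + 1) := by gcongr; linarith

end Ratio

/-! ### Expectations under the conditioned law. -/

section ConditionedTree

open scoped ENNReal

variable {Ω : Type*} [MeasurableSpace Ω] {P : Measure Ω} [IsProbabilityMeasure P]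
  {ξ : List ℕ → Ω → ℕ} {π : Measure ℕ} [IsProbabilityMeasure π]

/-- Up to a contribution of the root, the truncated degree moment is a sum of a function of the
numbers of children. -/
lemma setIntegral_truncatedDegreeMoment (hmeas : ∀ u, Measurable (ξ u))
    (hindep : iIndepFun ξ P) (hlaw : ∀ u, P.map (ξ u) = π) {q : ℝ} (hq : 0 ≤ q)
    (hmoment : Summable fun k : ℕ => (k : ℝ) ^ q * π.real {k}) (k₀ n : ℕ) :
    IntegrableOn (fun ω => truncatedDegreeMoment q k₀ (randomTree ξ ω)) (sizeEvent ξ (n + 1)) P ∧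
    (0 < n → |∫ ω in sizeEvent ξ (n + 1), truncatedDegreeMoment q k₀ (randomTree ξ ω) ∂P -
        tiltedMass (fun k => π.real {k}) (fun k => truncatedPow q k₀ (k + 1)) n n| ≤
      tiltedMass (fun k => π.real {k}) (fun k => ((k : ℝ) + 1) ^ q * k / n) n n) := by
  have hp : ∀ k, 0 ≤ π.real {k} := fun _ => measureReal_nonneg
  set s := sizeEvent ξ (n + 1)
  have hs : MeasurableSet s := measurableSet_sizeEvent hmeas _
  set W : Ω → ℝ≥0∞ := fun ω =>
    forestSum (fun k => ENNReal.ofReal (truncatedPow q k₀ (k + 1))) [[]] fun u => ξ u ω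
  set D : Ω → ℝ := fun ω => truncatedPow q k₀ (ξ [] ω) - truncatedPow q k₀ (ξ [] ω + 1)
  have hWm : Measurable W := (measurable_forestSum _ _).comp (measurable_pi_lambda _ hmeas)
  have hW := setLIntegral_forestSum hmeas hindep hlaw
    (f := fun k => truncatedPow q k₀ (k + 1)) (fun k => truncatedPow_nonneg _ _ _) n
  have hWint : IntegrableOn (fun ω => (W ω).toReal) s P :=
    integrable_toReal_of_lintegral_ne_top hWm.aemeasurable (by rw [hW]; exact ENNReal.ofReal_ne_top)
  have hDm : Measurable D :=
    (measurable_of_countable fun k => truncatedPow q k₀ k - truncatedPow q k₀ (k + 1)).comp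
      (hmeas [])
  -- Both terms of `D` lie in `[0, (ξ [] ω + 1)^q]`, hence so does their distance.
  have hDle : ∀ ω, ‖D ω‖ ≤ ((ξ [] ω : ℝ) + 1) ^ q := fun ω =>
    abs_sub_le_of_nonneg_of_le (truncatedPow_nonneg _ _ _) (truncatedPow_le hq k₀ (Nat.le_succ _))
      (truncatedPow_nonneg _ _ _) (truncatedPow_le hq k₀ le_rfl)
  have hEint : Integrable (fun ω => ((ξ [] ω : ℝ) + 1) ^ q) P := by
    have h1 : Integrable (fun k : ℕ => ((k : ℝ) + 1) ^ q) (P.map (ξ [])) := by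
      rw [hlaw]
      refine integrable_of_summable ((summable_succ_rpow_mul hq hmoment).congr fun k => ?_)
      rw [abs_of_nonneg (by positivity)]
    exact h1.comp_measurable (hmeas [])
  have hDint : Integrable D P :=
    hEint.mono' hDm.aestronglyMeasurable (Eventually.of_forall hDle)
  have hEq : Set.EqOn (fun ω => truncatedDegreeMoment q k₀ (randomTree ξ ω))
      (fun ω => (W ω).toReal + D ω) s := fun ω hω =>
    truncatedDegreeMoment_tree q k₀ (tree_finite_of_mem_sizeEvent hω)
  refine ⟨(hWint.add hDint.integrableOn).congr_fun hEq.symm hs, fun hn => ?_⟩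
  have hroot := setLIntegral_root hmeas hindep hlaw (f := fun k => ((k : ℝ) + 1) ^ q)
    (fun k => by positivity) hn
  rw [setIntegral_congr_fun hs hEq, integral_add hWint hDint.integrableOn,
    integral_toReal hWm.aemeasurable
      (ae_lt_top hWm (by rw [hW]; exact ENNReal.ofReal_ne_top)), hW,
    ENNReal.toReal_ofReal (tiltedMass_nonneg hp (fun k => truncatedPow_nonneg _ _ _) _ _),
    add_sub_cancel_left, ← Real.norm_eq_abs]
  refine (norm_integral_le_of_norm_le hEint.integrableOn (Eventually.of_forall hDle)).trans
    (le_of_eq ?_)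
  rw [integral_eq_lintegral_of_nonneg_ae (Eventually.of_forall fun ω => by positivity)
    hEint.integrableOn.aestronglyMeasurable, hroot, ENNReal.toReal_ofReal]
  exact tiltedMass_nonneg hp (fun k => by positivity) _ _

lemma sizeEvent_zero {Ω : Type*} (ξ : List ℕ → Ω → ℕ) : sizeEvent ξ 0 = ∅ := by
  ext ω
  simp only [Set.mem_empty_iff_false, iff_false]
  intro h
  have h1 : (randomTree ξ ω).encard = 0 := h
  have h2 : [] ∈ randomTree ξ ω := nil_mem_tree _
  rw [Set.encard_eq_zero.1 h1] at h2
  exact h2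

lemma integrable_truncatedDegreeMoment (hmeas : ∀ u, Measurable (ξ u))
    (hindep : iIndepFun ξ P) (hlaw : ∀ u, P.map (ξ u) = π) {q : ℝ} (hq : 0 ≤ q)
    (hmoment : Summable fun k : ℕ => (k : ℝ) ^ q * π.real {k}) (k₀ n : ℕ) :
    Integrable (fun ω => truncatedDegreeMoment q k₀ (randomTree ξ ω)) (condMeasure P ξ n) := by
  -- When the size `n` is impossible, the conditioned measure is zero and integrability is trivial.
  by_cases hP : P (sizeEvent ξ n) = 0
  · rw [condMeasure, cond_eq_zero_of_meas_eq_zero hP]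
    exact integrable_zero_measure
  · cases n with
    | zero => exact absurd (by rw [sizeEvent_zero, measure_empty]) hP
    | succ n =>
      exact (setIntegral_truncatedDegreeMoment hmeas hindep hlaw hq hmoment k₀ n).1.smul_measure
        (ENNReal.inv_ne_top.2 hP)

/-- The factor `1/(n+1)` cancels the `n + 1` of the Otter-Dwass formula, so only division by
`W_{n+1}(n)` remains. -/
lemma abs_condExpectation_sub_le (hmeas : ∀ u, Measurable (ξ u))
    (hindep : iIndepFun ξ P) (hlaw : ∀ u, P.map (ξ u) = π) {q : ℝ} (hq : 0 ≤ q)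
    (hmoment : Summable fun k : ℕ => (k : ℝ) ^ q * π.real {k}) (k₀ : ℕ) {n : ℕ} (hn : 0 < n)
    (hw : 0 < walkMass (fun k => π.real {k}) (n + 1) n) :
    |1 / ((n + 1 : ℕ) : ℝ) *
        ∫ ω, truncatedDegreeMoment q k₀ (randomTree ξ ω) ∂(condMeasure P ξ (n + 1)) -
      tiltedMass (fun k => π.real {k}) (fun k => truncatedPow q k₀ (k + 1)) n n /
        walkMass (fun k => π.real {k}) (n + 1) n| ≤
      tiltedMass (fun k => π.real {k}) (fun k => ((k : ℝ) + 1) ^ q * k / n) n n /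
        walkMass (fun k => π.real {k}) (n + 1) n := by
  have h := (setIntegral_truncatedDegreeMoment hmeas hindep hlaw hq hmoment k₀ n).2 hn
  rw [condMeasure, ProbabilityTheory.cond, integral_smul_measure,
    measure_sizeEvent hmeas hindep hlaw,
    ENNReal.toReal_inv, ENNReal.toReal_ofReal (by positivity), smul_eq_mul, inv_div, ← mul_assoc,
    show 1 / ((n + 1 : ℕ) : ℝ) * (((n : ℝ) + 1) / walkMass (fun k => π.real {k}) (n + 1) n) =
      (walkMass (fun k => π.real {k}) (n + 1) n)⁻¹ by push_cast; field_simp,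
    inv_mul_eq_div, ← sub_div, abs_div, abs_of_pos hw]
  gcongr

end ConditionedTree

end GaltonWatson

end

/-! ### Conclusion: the main term and the root error. -/

theorem mainTheorem12
    -- the offspring distribution: critical, nondegenerate, of finite variance
    (π : Measure ℕ) [IsProbabilityMeasure π]
    (hmean : HasSum (fun k : ℕ => (k : ℝ) * π.real {k}) 1)
    (hone : π.real {1} < 1)
    (hvar : Summable fun k : ℕ => (k : ℝ) ^ 2 * π.real {k})
    -- i.i.d. numbers of children, indexed by the individuals, on any probability space
    {Ω : Type*} [MeasurableSpace Ω] (P : Measure Ω) [IsProbabilityMeasure P]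
    (ξ : List ℕ → Ω → ℕ) (hmeas : ∀ u, Measurable (ξ u))
    (hindep : iIndepFun ξ P) (hlaw : ∀ u, P.map (ξ u) = π)
    (q : ℝ) (hq : 1 < q)
    (hmoment : Summable fun k : ℕ => (k : ℝ) ^ q * π.real {k})
    (k₀ : ℕ) :
    (∀ᶠ m : ℕ in atTop, P (GaltonWatson.sizeEvent ξ (GaltonWatson.period π * m + 1)) ≠ 0) ∧
    (∀ n : ℕ, Integrable
      (fun ω => GaltonWatson.truncatedDegreeMoment q k₀ (GaltonWatson.randomTree ξ ω))
      (GaltonWatson.condMeasure P ξ n)) ∧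
    (Summable fun k : ℕ => if k₀ ≤ k + 1 then ((k : ℝ) + 1) ^ q * π.real {k} else 0) ∧
    Tendsto
      (fun m : ℕ =>
        1 / ((GaltonWatson.period π * m + 1 : ℕ) : ℝ) *
          ∫ ω, GaltonWatson.truncatedDegreeMoment q k₀ (GaltonWatson.randomTree ξ ω)
            ∂(GaltonWatson.condMeasure P ξ (GaltonWatson.period π * m + 1)))
      atTop
      (𝓝 (∑' k : ℕ, if k₀ ≤ k + 1 then ((k : ℝ) + 1) ^ q * π.real {k} else 0)) := by
  have hq0 : 0 ≤ q := by linarith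
  have hb := GaltonWatson.summable_succ_rpow_mul hq0 hmoment
  have hpos := GaltonWatson.eventually_walkMass_pos hmean hone hvar
  have hN := GaltonWatson.tendsto_period_mul hmean
  have hterm : (fun k : ℕ => if k₀ ≤ k + 1 then ((k : ℝ) + 1) ^ q * π.real {k} else 0) =
      fun k => GaltonWatson.truncatedPow q k₀ (k + 1) * π.real {k} := by
    ext k
    simp [GaltonWatson.truncatedPow]
  refine ⟨?_, fun n =>
    GaltonWatson.integrable_truncatedDegreeMoment hmeas hindep hlaw hq0 hmoment k₀ n, ?_, ?_⟩
  · filter_upwards [hpos] with m hm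
    rw [GaltonWatson.measure_sizeEvent hmeas hindep hlaw]
    exact (ENNReal.ofReal_pos.2 (by positivity)).ne'
  · refine Summable.of_nonneg_of_le (fun k => ?_) (fun k => ?_) hb
    · split_ifs <;> positivity
    · split_ifs
      · exact le_rfl
      · positivity
  · rw [hterm]
    have hmain := GaltonWatson.tendsto_tiltedMass_div hmean hone hvar hb
      (F := fun _ k => GaltonWatson.truncatedPow q k₀ (k + 1))
      (fun _ _ => GaltonWatson.truncatedPow_nonneg _ _ _)
      (fun _ _ _ => GaltonWatson.truncatedPow_le hq0 k₀ le_rfl) (fun _ => tendsto_const_nhds)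
    have herr := GaltonWatson.tendsto_tiltedMass_div hmean hone hvar hb (f := fun _ => 0)
      (F := fun m k => ((k : ℝ) + 1) ^ q * k / ((GaltonWatson.period π * m : ℕ) : ℝ))
      (fun _ _ => by positivity)
      -- `k ≤ d m` gives `k / (d m) ≤ 1`; for `m = 0` the quotient is 0 by convention, and the bound
      -- still holds.
      (fun m k hk => div_le_of_le_mul₀ (by positivity) (by positivity) (by gcongr))
      (fun k => (tendsto_const_div_atTop_nhds_zero_nat _).comp hN)
    simp only [zero_mul, tsum_zero] at herr
    refine tendsto_of_tendsto_of_dist hmain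
      (squeeze_zero' (Eventually.of_forall fun _ => dist_nonneg) ?_ herr)
    filter_upwards [hpos, hN.eventually_gt_atTop 0] with m hm hm0
    rw [dist_comm, Real.dist_eq]
    exact GaltonWatson.abs_condExpectation_sub_le hmeas hindep hlaw hq0 hmoment k₀ hm0 hm
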